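/- For $q\in(0,1)$ let $\mathrm{Geo}(q)$ be the distribution on $\mathbb N_0=\{0,1,2,\dots\}$ with weights $(1-q)q^x$, let $M_0,M_1,\dots$ be its orthonormal polynomials, $\deg M_n=n$, with leading coefficients $\kappa_n>0$, and put $\mu_q=(1+q^{1/2})^2/(1-q)$. For $N\ge 1$ let $\lambda_1\ge\dots\ge\lambda_N$ be the points of the $N\times N$ Meixner ensemble, i.e. of the determinantal point process on $\mathbb N_0$ whose kernel with respect to $\mathrm{Geo}(q)$ is $$K_N(x,y)=\frac{\kappa_{N-1}}{\kappa_N}\cdot\frac{M_N(x)M_{N-1}(y)-M_{N-1}(x)M_N(y)}{x-y}$$ (for $x=y$: the limit $y\to x$ of the right-hand side over the reals), and let $$\nu_{q,N}=\mathbb E\Bigl[\frac1N\sum_{i=1}^N\delta_{\lambda_i}\Bigr]$$ be its expected empirical distribution. There exist positive absolute constants $c$ and $N_0$ such that, for all integers $N\ge N_0$, all $\varepsilon\in(0,\tfrac12)$ and all $q\in[\varepsilon^3,1)$ with $q\ge N^{-2}$, a random variable $X$ with distribution $\nu_{q,N}$ satisfies $$\mathbb P\bigl(X\ge \mu_q N(1-q^{1/6}\varepsilon)\bigr)\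 \ge\ c\,\varepsilon^{3/2}.$$ -/

import Mathlib

open MeasureTheory ProbabilityTheory Polynomial
open scoped ENNReal

namespace Meixner

/-! ### The geometric reference measure -/

/-- The distribution Geo(`q`) on `ℕ = {0, 1, 2, …}`: the geometric distribution with success
probability `1 - q`, i.e. with weights `(1 - q) q ^ x` (see `geo_real_singleton`). -/
noncomputable def geo (q : ℝ) : Measure ℕ :=
  geometricMeasure (Set.projIcc 0 1 zero_le_one (1 - q))

instance (q : ℝ) : IsProbabilityMeasure (geo q) := by
  unfold geo; infer_instance

theorem coe_projIcc {q : ℝ} (h0 : 0 < q) (h1 : q < 1) :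
    ((Set.projIcc (0 : ℝ) 1 zero_le_one (1 - q) : unitInterval) : ℝ) = 1 - q := by
  rw [Set.projIcc_of_mem zero_le_one ⟨by linarith, by linarith⟩]

theorem projIcc_ne_zero {q : ℝ} (h0 : 0 < q) (h1 : q < 1) :
    (Set.projIcc (0 : ℝ) 1 zero_le_one (1 - q) : unitInterval) ≠ 0 := by
  intro h
  have h2 := coe_projIcc h0 h1
  rw [h] at h2
  simp at h2
  linarith

theorem geo_real_singleton {q : ℝ} (h0 : 0 < q) (h1 : q < 1) (x : ℕ) :
    (geo q).real {x} = (1 - q) * q ^ x := by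
  unfold geo
  rw [geometricMeasure_real_singleton (projIcc_ne_zero h0 h1), coe_projIcc h0 h1]
  ring

/-! ### The orthonormal polynomials -/

/-- The inner product of two real polynomials in `L²(Geo(q))`. -/
noncomputable def ip (q : ℝ) (f g : ℝ[X]) : ℝ :=
  ∫ x : ℕ, f.eval (x : ℝ) * g.eval (x : ℝ) ∂(geo q)

/-- The monic orthogonal polynomials of Geo(`q`), by the Gram-Schmidt procedure applied to
`1, X, X ^ 2, …`. -/
noncomputable def monicOrtho (q : ℝ) : ℕ → ℝ[X]
  | n => X ^ n - ∑ k : Fin n,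
      C (ip q (X ^ n) (monicOrtho q k) / ip q (monicOrtho q k) (monicOrtho q k)) * monicOrtho q k

/-- The orthonormal polynomials `M_0, M_1, …` of Geo(`q`), normalised to have positive leading
coefficients. -/
noncomputable def M (q : ℝ) (n : ℕ) : ℝ[X] :=
  C (Real.sqrt (ip q (monicOrtho q n) (monicOrtho q n)))⁻¹ * monicOrtho q n

theorem integrable_poly {q : ℝ} (h0 : 0 < q) (h1 : q < 1) (f : ℝ[X]) :
    Integrable (fun x : ℕ => f.eval (x : ℝ)) (geo q) := by
  induction f using Polynomial.induction_on' with
  | add f g hf hg =>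
    simp only [eval_add]
    exact hf.add hg
  | monomial n a =>
    simp only [eval_monomial]
    refine Integrable.const_mul ?_ a
    unfold geo
    rw [integrable_geometricMeasure_iff (projIcc_ne_zero h0 h1), coe_projIcc h0 h1]
    have hs := (summable_pow_mul_geometric_of_norm_lt_one (R := ℝ) n (r := q)
      (by rw [Real.norm_eq_abs, abs_of_pos h0]; exact h1)).mul_left (1 - q)
    refine hs.congr fun k => ?_
    rw [Real.norm_of_nonneg (by positivity)]
    ring

theorem integrable_mul {q : ℝ} (h0 : 0 < q) (h1 : q < 1) (f g : ℝ[X]) :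
    Integrable (fun x : ℕ => f.eval (x : ℝ) * g.eval (x : ℝ)) (geo q) := by
  simpa using integrable_poly h0 h1 (f * g)

theorem ip_comm (q : ℝ) (f g : ℝ[X]) : ip q f g = ip q g f := by
  unfold ip; simp only [mul_comm]

theorem ip_C_mul (q a : ℝ) (f g : ℝ[X]) : ip q (C a * f) g = a * ip q f g := by
  unfold ip
  rw [← integral_const_mul]
  simp only [eval_mul, eval_C, mul_assoc]

theorem ip_sub {q : ℝ} (h0 : 0 < q) (h1 : q < 1) (f g h : ℝ[X]) :
    ip q (f - g) h = ip q f h - ip q g h := by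
  unfold ip
  rw [← integral_sub (integrable_mul h0 h1 f h) (integrable_mul h0 h1 g h)]
  simp only [eval_sub, sub_mul]

theorem ip_sum {q : ℝ} (h0 : 0 < q) (h1 : q < 1) {ι : Type*} (s : Finset ι) (f : ι → ℝ[X])
    (h : ℝ[X]) : ip q (∑ i ∈ s, f i) h = ∑ i ∈ s, ip q (f i) h := by
  unfold ip
  rw [← integral_finsetSum s (fun i _ => integrable_mul h0 h1 (f i) h)]
  simp only [eval_finsetSum, Finset.sum_mul]

theorem ip_self_pos {q : ℝ} (h0 : 0 < q) (h1 : q < 1) {f : ℝ[X]} (hf : f ≠ 0) :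
    0 < ip q f f := by
  obtain ⟨n, hn⟩ : ∃ n : ℕ, f.eval (n : ℝ) ≠ 0 := by
    by_contra! h
    exact hf (Polynomial.eq_zero_of_infinite_isRoot f
      ((Set.infinite_range_of_injective Nat.cast_injective).mono
        (by rintro _ ⟨n, rfl⟩; exact h n)))
  unfold ip
  rw [integral_pos_iff_support_of_nonneg (fun x => mul_self_nonneg _) (integrable_mul h0 h1 f f)]
  have h2 : 0 < (geo q).real {n} := by
    rw [geo_real_singleton h0 h1]
    have : 0 < 1 - q := by linarith
    positivity
  have h3 : 0 < geo q {n} := (ENNReal.toReal_pos_iff.1 h2).1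
  refine h3.trans_le (measure_mono ?_)
  rintro _ rfl
  simpa using hn

theorem monicOrtho_monic (q : ℝ) (n : ℕ) :
    (monicOrtho q n).Monic ∧ (monicOrtho q n).natDegree = n := by
  induction n using Nat.strong_induction_on with
  | _ n ih =>
    have hd : (∑ k : Fin n, C (ip q (X ^ n) (monicOrtho q k) /
        ip q (monicOrtho q k) (monicOrtho q k)) * monicOrtho q k).degree < (n : ℕ) := by
      refine (Polynomial.degree_sum_le _ _).trans_lt ?_
      refine (Finset.sup_lt_iff (WithBot.bot_lt_coe n)).2 ?_
      intro k _
      rw [← Polynomial.smul_eq_C_mul]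
      refine (Polynomial.degree_smul_le _ _).trans_lt ?_
      rw [Polynomial.degree_eq_natDegree (ih k k.2).1.ne_zero, (ih k k.2).2]
      exact Nat.cast_lt.2 k.2
    rw [monicOrtho]
    have hm := Polynomial.monic_X_pow_sub hd
    refine ⟨hm, ?_⟩
    apply Polynomial.natDegree_eq_of_degree_eq_some
    rw [Polynomial.degree_sub_eq_left_of_degree_lt (by simpa using hd)]
    simp

theorem monicOrtho_ortho {q : ℝ} (h0 : 0 < q) (h1 : q < 1) (n : ℕ) :
    ∀ m < n, ip q (monicOrtho q n) (monicOrtho q m) = 0 := by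
  induction n using Nat.strong_induction_on with
  | _ n ih =>
    intro m hm
    have hpos := ip_self_pos h0 h1 (monicOrtho_monic q m).1.ne_zero
    rw [monicOrtho, ip_sub h0 h1, ip_sum h0 h1, Finset.sum_eq_single (⟨m, hm⟩ : Fin n)]
    · rw [ip_C_mul]
      field_simp
      ring
    · intro k _ hk
      rw [ip_C_mul]
      have hk' : (k : ℕ) ≠ m := fun h => hk (Fin.ext h)
      rcases lt_or_gt_of_ne hk' with h | h
      · rw [ip_comm q (monicOrtho q k) (monicOrtho q m), ih m hm k h, mul_zero]
      · rw [ih k k.2 m h, mul_zero]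
    · simp

/-- The `M q n` are orthonormal in `L²(Geo(q))`. -/
theorem M_orthonormal {q : ℝ} (h0 : 0 < q) (h1 : q < 1) (m n : ℕ) :
    ip q (M q m) (M q n) = if m = n then 1 else 0 := by
  unfold M
  rw [ip_C_mul, ip_comm q (monicOrtho q m) (C _ * _), ip_C_mul]
  split_ifs with h
  · subst h
    have hpos := ip_self_pos h0 h1 (monicOrtho_monic q m).1.ne_zero
    rw [← mul_assoc, ← mul_inv, Real.mul_self_sqrt hpos.le, inv_mul_cancel₀ hpos.ne']
  · rcases lt_or_gt_of_ne h with h | h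
    · rw [monicOrtho_ortho h0 h1 n m h, mul_zero, mul_zero]
    · rw [ip_comm q (monicOrtho q n) (monicOrtho q m), monicOrtho_ortho h0 h1 m n h, mul_zero, mul_zero]

/-- `M q n` has degree `n` and positive leading coefficient. -/
theorem M_natDegree_leadingCoeff {q : ℝ} (h0 : 0 < q) (h1 : q < 1) (n : ℕ) :
    (M q n).natDegree = n ∧ 0 < (M q n).leadingCoeff := by
  have hpos := ip_self_pos h0 h1 (monicOrtho_monic q n).1.ne_zero
  have hc : 0 < (Real.sqrt (ip q (monicOrtho q n) (monicOrtho q n)))⁻¹ := by positivity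
  unfold M
  constructor
  · rw [Polynomial.natDegree_C_mul hc.ne', (monicOrtho_monic q n).2]
  · rw [Polynomial.leadingCoeff_mul, leadingCoeff_C, (monicOrtho_monic q n).1.leadingCoeff, mul_one]
    exact hc

/-! ### The Meixner ensemble -/

/-- The kernel `K_N` of the `N × N` Meixner ensemble (`1 ≤ N`) in Christoffel-Darboux form. On the
diagonal it is the limit `y → x` of the off-diagonal expression, over real `x` and `y`. -/
noncomputable def kernel (q : ℝ) (N : ℕ) (x y : ℕ) : ℝ :=
  (M q (N - 1)).leadingCoeff / (M q N).leadingCoeff *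
    if x = y then
      (M q N).derivative.eval (x : ℝ) * (M q (N - 1)).eval (x : ℝ)
        - (M q (N - 1)).derivative.eval (x : ℝ) * (M q N).eval (x : ℝ)
    else
      ((M q N).eval (x : ℝ) * (M q (N - 1)).eval (y : ℝ)
        - (M q (N - 1)).eval (x : ℝ) * (M q N).eval (y : ℝ)) / ((x : ℝ) - (y : ℝ))

/-- `P`, the joint law of `N` random points `l 0, …, l (N - 1)` of `ℕ`, is determinantal with
kernel `K` with respect to `μ`: for every `r`, the `r`-th factorial moment measure of the point
process `∑ i, δ_{l i}` (the expected number of `r`-tuples of points with pairwise distinct labels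
that sit at `x 0, …, x (r - 1)`) has the density `det (K (x i) (x j))` with respect to the `r`-fold
product of `μ`. The condition does not depend on how the points are labelled. -/
def IsDeterminantal {N : ℕ} (P : Measure (Fin N → ℕ)) (μ : Measure ℕ) (K : ℕ → ℕ → ℝ) : Prop :=
  ∀ (r : ℕ) (x : Fin r → ℕ),
    ∑ e : Fin r ↪ Fin N, P.real {l | ∀ j, l (e j) = x j} =
      (Matrix.of fun i j => K (x i) (x j)).det * ∏ j, μ.real {x j}

/-- `P` is the joint law of the points of the `N × N` Meixner ensemble with parameter `q`, in any
labelling (for instance the decreasing one). -/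
structure IsMeixnerEnsemble (q : ℝ) (N : ℕ) (P : Measure (Fin N → ℕ)) : Prop where
  isProbabilityMeasure : IsProbabilityMeasure P
  isDeterminantal : IsDeterminantal P (geo q) (kernel q N)

/-- The expected empirical distribution `E[(1/N) ∑ i, δ_{l i}]` of `N` random points with joint
law `P`. -/
noncomputable def meanEmpirical {N : ℕ} (P : Measure (Fin N → ℕ)) : Measure ℕ :=
  P.bind fun l => (N : ℝ≥0∞)⁻¹ • ∑ i, Measure.dirac (l i)

theorem meanEmpirical_apply {N : ℕ} (P : Measure (Fin N → ℕ)) (s : Set ℕ) :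
    meanEmpirical P s = (N : ℝ≥0∞)⁻¹ * ∑ i, P {l | l i ∈ s} := by
  have hs : MeasurableSet s := MeasurableSet.of_discrete
  have hm : Measurable fun l : Fin N → ℕ =>
      (N : ℝ≥0∞)⁻¹ • ∑ i, Measure.dirac (l i) := Measurable.of_discrete
  have hpre : ∀ i : Fin N, {l : Fin N → ℕ | l i ∈ s} = (fun l : Fin N → ℕ => l i) ⁻¹' s :=
    fun i => rfl
  unfold meanEmpirical
  rw [Measure.bind_apply hs hm.aemeasurable]
  simp only [Measure.smul_apply, Measure.finsetSum_apply, smul_eq_mul, Measure.dirac_apply' _ hs]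
  rw [lintegral_const_mul _ Measurable.of_discrete,
    lintegral_finsetSum _ (fun i _ => Measurable.of_discrete)]
  congr 1
  refine Finset.sum_congr rfl fun i _ => ?_
  rw [← lintegral_indicator_one (μ := P) (s := {l | l i ∈ s}) MeasurableSet.of_discrete]
  rfl

/-- `μ_q = (1 + √q)² / (1 - q)`. -/
noncomputable def edge (q : ℝ) : ℝ := (1 + Real.sqrt q) ^ 2 / (1 - q)

end Meixner

namespace Meixner

/-! ### The Jacobi coefficients -/

/-! Let `a_n`, `b_n` be the diagonal and off-diagonal Jacobi coefficients of Geo(`q`). The expected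
number of points at or above a level `T` is `∑_{n<N} ∫_{x ≥ T} M_n²`. The Jacobi matrix acts at
slowly varying sequences as multiplication by `a_n + b_n + b_{n+1}`, which is `μ_q n` plus a
constant, plus a discrete second-order operator of strength `b_n`. So a smooth bump of coefficients
over a window of about `j` degrees in which this potential exceeds `T` by a quantity comparable to
`m`, with `b ≲ m j²`, is a polynomial `F` for which `x - T` has mean of order `m` and second moment
of order `m²`. A constant proportion of `F²` then sits on `[T, T + O(m)]`, and by Cauchy-Schwarz the
window carries at least a fixed expected number of points there (`window_mass`).

Write `q = r⁶`, `ε = η²`. If `N η³ ≥ 160`, put `T = μ_q N (1 - r η²)` and `j ≍ r/η`: about `N η³`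
disjoint windows fit just below degree `N`, each contributing a constant (`bulk_mass`). The
condition `q ≥ ε³` says `r/η ≥ 1`.

If `N η³ < 160`, a constant expected number of points beyond `μ_q N` is enough (`edge_mass`). A
window whose potential exceeds `μ_q N` has degrees above `N`, which do not enter `K_N`. It is placed
at distance `≍ j` above `N` on the Airy scale `j ≍ r N^{1/3}`, and its polynomials are compared with
those of degrees `N - j, …, N - 1`. For `x ≥ μ_q N` the values `M_n(x)` are positive and increasing
up to `n = N`, and a discrete Gronwall argument shows that they grow by at most a constant factor
over `O(j)` further degrees (`abs_eval_le`). The condition `q ≥ N⁻²` says `r N^{1/3} ≥ 1`.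

The exact values of `a_n` and `b_n` come from the hypergeometric formula for the Meixner
polynomials; Christoffel-Darboux turns the diagonal of the kernel into `∑ M_n²`. -/

/-- The diagonal entries of the Jacobi matrix of Geo(`q`). -/
noncomputable def diagCoeff (q : ℝ) (n : ℕ) : ℝ := (n + q * (n + 1)) / (1 - q)

/-- The off-diagonal entries of the Jacobi matrix of Geo(`q`). -/
noncomputable def offCoeff (q : ℝ) (n : ℕ) : ℝ := Real.sqrt q * n / (1 - q)

theorem offCoeff_zero (q : ℝ) : offCoeff q 0 = 0 := by simp [offCoeff]

theorem offCoeff_pos {q : ℝ} (h0 : 0 < q) (h1 : q < 1) (n : ℕ) : 0 < offCoeff q (n + 1) := by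
  have : 0 < 1 - q := by linarith
  have := Real.sqrt_pos.2 h0
  unfold offCoeff
  positivity

/-- The Meixner polynomials, normalised by their three-term recurrence. -/
noncomputable def jacobiPoly (q : ℝ) : ℕ → ℝ[X]
  | 0 => 1
  | 1 => C (offCoeff q 1)⁻¹ * (X - C (diagCoeff q 0))
  | n + 2 => C (offCoeff q (n + 2))⁻¹ *
      ((X - C (diagCoeff q (n + 1))) * jacobiPoly q (n + 1)
        - C (offCoeff q (n + 1)) * jacobiPoly q n)

/-- The truncated index `n - 1` is harmless at `n = 0` because `offCoeff q 0 = 0`, so one recurrence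
serves all degrees. -/
theorem jacobiPoly_succ {q : ℝ} (h0 : 0 < q) (h1 : q < 1) (n : ℕ) :
    C (offCoeff q (n + 1)) * jacobiPoly q (n + 1) =
      (X - C (diagCoeff q n)) * jacobiPoly q n - C (offCoeff q n) * jacobiPoly q (n - 1) := by
  have hne := (offCoeff_pos h0 h1 n).ne'
  cases n with
  | zero =>
    simp only [zero_add, jacobiPoly, offCoeff_zero] at hne ⊢
    rw [← mul_assoc, ← C_mul, mul_inv_cancel₀ hne]
    simp
  | succ n =>
    rw [jacobiPoly, ← mul_assoc, ← C_mul, mul_inv_cancel₀ hne]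
    simp

theorem jacobiPoly_degree_lc {q : ℝ} (h0 : 0 < q) (h1 : q < 1) (n : ℕ) :
    (jacobiPoly q n).natDegree = n ∧ 0 < (jacobiPoly q n).leadingCoeff := by
  induction n using Nat.strong_induction_on with
  | _ n ih =>
    match n, ih with
    | 0, _ => simp [jacobiPoly]
    | n + 1, ih =>
      obtain ⟨hd, hl⟩ := ih n (by omega)
      have hb := offCoeff_pos h0 h1 n
      have hne : jacobiPoly q n ≠ 0 := leadingCoeff_ne_zero.1 hl.ne'
      have hA : ((X - C (diagCoeff q n)) * jacobiPoly q n).natDegree = n + 1 := by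
        rw [natDegree_mul (X_sub_C_ne_zero _) hne, natDegree_X_sub_C, hd, add_comm]
      have hAl : ((X - C (diagCoeff q n)) * jacobiPoly q n).leadingCoeff =
          (jacobiPoly q n).leadingCoeff := by
        rw [leadingCoeff_mul, leadingCoeff_X_sub_C, one_mul]
      have hB : (C (offCoeff q n) * jacobiPoly q (n - 1)).natDegree <
          ((X - C (diagCoeff q n)) * jacobiPoly q n).natDegree := by
        rw [hA]
        refine (natDegree_C_mul_le _ _).trans_lt ?_
        rw [(ih (n - 1) (by omega)).1]
        omega
      have hdeg := natDegree_sub_eq_left_of_natDegree_lt hB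
      have hlc := leadingCoeff_sub_of_degree_lt (degree_lt_degree hB)
      rw [← jacobiPoly_succ h0 h1] at hdeg hlc
      rw [natDegree_C_mul hb.ne', hA] at hdeg
      rw [leadingCoeff_mul, leadingCoeff_C, hAl] at hlc
      refine ⟨hdeg, ?_⟩
      rw [← hlc] at hl
      exact (pos_iff_pos_of_mul_pos hl).1 hb

/-- Compare coefficients of `X ^ (n + 1)` in the recurrence. This identifies the prefactor
`κ_{N-1}/κ_N` of the kernel with `b_N`. -/
theorem offCoeff_mul_leadingCoeff {q : ℝ} (h0 : 0 < q) (h1 : q < 1) (n : ℕ) :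
    offCoeff q (n + 1) * (jacobiPoly q (n + 1)).leadingCoeff = (jacobiPoly q n).leadingCoeff := by
  have h := congrArg (fun p : ℝ[X] => p.coeff (n + 1)) (jacobiPoly_succ h0 h1 n)
  have e1 := (jacobiPoly_degree_lc h0 h1 n).1
  have e2 := (jacobiPoly_degree_lc h0 h1 (n + 1)).1
  have e3 := (jacobiPoly_degree_lc h0 h1 (n - 1)).1
  simp only [coeff_C_mul, coeff_sub, sub_mul, coeff_X_mul] at h
  rw [coeff_eq_zero_of_natDegree_lt (p := jacobiPoly q (n - 1)) (by omega),
    coeff_eq_zero_of_natDegree_lt (p := jacobiPoly q n) (n := n + 1) (by omega)] at h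
  unfold leadingCoeff
  rw [e1, e2]
  simpa using h

/-! ### The explicit formula -/

/-- The hypergeometric form of the Meixner polynomials at natural numbers. -/
noncomputable def hyperSum (z : ℝ) (n x : ℕ) : ℝ :=
  ∑ k ∈ Finset.range (n + 1), (n.choose k : ℝ) * (x.choose k : ℝ) * z ^ k

theorem hyperSum_eq (z : ℝ) {n R : ℕ} (h : n < R) (x : ℕ) :
    hyperSum z n x = ∑ k ∈ Finset.range R, (n.choose k : ℝ) * (x.choose k : ℝ) * z ^ k := by
  unfold hyperSum
  refine Finset.sum_subset (by intro k; simp; omega) ?_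
  intro k _ hk
  rw [Nat.choose_eq_zero_of_lt (by simpa using hk)]
  simp

/-- This is the coefficient of `x.choose k * z ^ k` in the degree recurrence for `hyperSum`. -/
theorem mul_choose_recurrence (q : ℝ) (n k : ℕ) :
    (q - 1) * (k * n.choose k) + q * (k * n.choose (k - 1)) =
      q * (n + 1) * (n + 1).choose k - (n + q * (n + 1)) * n.choose k
        + n * (n - 1).choose k := by
  cases k with
  | zero => simp
  | succ k =>
    have e1 : ((n : ℝ) + 1) * n.choose k = (n + 1).choose (k + 1) * (k + 1) := by
      exact_mod_cast Nat.add_one_mul_choose_eq n k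
    have e2 : ((n + 1).choose (k + 1) : ℝ) = n.choose k + n.choose (k + 1) := by
      exact_mod_cast Nat.choose_succ_succ n k
    have e3 : (n : ℝ) * (n - 1).choose (k + 1) = n * n.choose (k + 1) - (k + 1) * n.choose (k + 1) := by
      cases n with
      | zero => simp
      | succ n =>
        have f1 : ((n : ℝ) + 1) * n.choose k = (n + 1).choose (k + 1) * (k + 1) := by
          exact_mod_cast Nat.add_one_mul_choose_eq n k
        have f2 : ((n + 1).choose (k + 1) : ℝ) = n.choose k + n.choose (k + 1) := by
          exact_mod_cast Nat.choose_succ_succ n k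
        simp only [Nat.add_sub_cancel]
        push_cast
        linear_combination (-(n : ℝ) - 1) * f2 - f1
    rw [e3]
    simp only [Nat.add_sub_cancel]
    push_cast
    linear_combination (-q * (n + 1) - q * (k + 1)) * e2 + (-q) * e1

theorem hyperSum_recurrence {q : ℝ} (h0 : 0 < q) (n x : ℕ) :
    (q - 1) * x * hyperSum (1 - 1 / q) n x =
      q * (n + 1) * hyperSum (1 - 1 / q) (n + 1) x
        - (n + q * (n + 1)) * hyperSum (1 - 1 / q) n x
        + n * hyperSum (1 - 1 / q) (n - 1) x := by
  set z : ℝ := 1 - 1 / q with hz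
  have hqz : q * z = q - 1 := by rw [hz]; field_simp
  -- Multiplication by `x` raises the lower index of `x.choose k` by at most one; `q z = q - 1`
  -- absorbs the resulting shift in the power of `z`.
  have hx : ∀ k : ℕ, (x : ℝ) * x.choose k = k * x.choose k + (k + 1) * x.choose (k + 1) := by
    intro k
    have e1 : ((x : ℝ) + 1) * x.choose k = (x + 1).choose (k + 1) * (k + 1) := by
      exact_mod_cast Nat.add_one_mul_choose_eq x k
    have e2 : ((x + 1).choose (k + 1) : ℝ) = x.choose k + x.choose (k + 1) := by
      exact_mod_cast Nat.choose_succ_succ x k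
    linear_combination e1 + (k + 1 : ℝ) * e2
  rw [hyperSum_eq z (R := n + 3) (n := n) (by omega), hyperSum_eq z (R := n + 3) (n := n + 1) (by omega),
    hyperSum_eq z (R := n + 3) (n := n - 1) (by omega)]
  have e : (q - 1) * x * ∑ k ∈ Finset.range (n + 3), (n.choose k : ℝ) * (x.choose k : ℝ) * z ^ k =
      ∑ k ∈ Finset.range (n + 3), (q - 1) * (k * n.choose k) * (x.choose k : ℝ) * z ^ k +
      ∑ k ∈ Finset.range (n + 3), q * (((k + 1 : ℕ) : ℝ) * n.choose (k + 1 - 1)) *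
        (x.choose (k + 1) : ℝ) * z ^ (k + 1) := by
    rw [Finset.mul_sum, ← Finset.sum_add_distrib]
    refine Finset.sum_congr rfl fun k _ => ?_
    simp only [Nat.add_sub_cancel]
    push_cast
    rw [pow_succ]
    linear_combination (q - 1) * n.choose k * z ^ k * hx k -
      (k + 1 : ℝ) * n.choose k * x.choose (k + 1) * z ^ k * hqz
  have e' : ∑ k ∈ Finset.range (n + 3), q * (((k + 1 : ℕ) : ℝ) * n.choose (k + 1 - 1)) *
        (x.choose (k + 1) : ℝ) * z ^ (k + 1) =
      ∑ k ∈ Finset.range (n + 3), q * ((k : ℝ) * n.choose (k - 1)) *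
        (x.choose k : ℝ) * z ^ k := by
    have := Finset.sum_range_succ' (fun k : ℕ => q * ((k : ℝ) * n.choose (k - 1)) *
        (x.choose k : ℝ) * z ^ k) (n + 3)
    rw [Finset.sum_range_succ] at this
    simp only [Nat.cast_zero, zero_mul, mul_zero, add_zero] at this
    rw [← this, Nat.choose_eq_zero_of_lt (show n < n + 3 - 1 by omega)]
    simp
  rw [e, e', ← Finset.sum_add_distrib, Finset.mul_sum, Finset.mul_sum, Finset.mul_sum,
    ← Finset.sum_sub_distrib, ← Finset.sum_add_distrib]
  refine Finset.sum_congr rfl fun k _ => ?_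
  linear_combination (x.choose k : ℝ) * z ^ k * mul_choose_recurrence q n k

theorem jacobiPoly_eval {q : ℝ} (h0 : 0 < q) (h1 : q < 1) (n x : ℕ) :
    (jacobiPoly q n).eval (x : ℝ) = (-Real.sqrt q) ^ n * hyperSum (1 - 1 / q) n x := by
  have hs := Real.sq_sqrt h0.le
  have hs0 := Real.sqrt_pos.2 h0
  have hq : (1 - q) ≠ 0 := by linarith
  induction n using Nat.strong_induction_on with
  | _ n ih =>
    match n, ih with
    | 0, _ => simp [jacobiPoly, hyperSum]
    | n + 1, ih =>
      have h := congrArg (Polynomial.eval (x : ℝ)) (jacobiPoly_succ h0 h1 n)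
      simp only [eval_mul, eval_sub, eval_C, eval_X] at h
      have hb := (offCoeff_pos h0 h1 n).ne'
      apply mul_left_cancel₀ hb
      have hr := hyperSum_recurrence h0 n x
      rw [h, ih n (by omega), ih (n - 1) (by omega)]
      unfold offCoeff diagCoeff
      clear ih hb h
      generalize hyperSum (1 - 1 / q) = H at *
      cases n with
      | zero =>
        push_cast at hr ⊢
        field_simp
        simp only [zero_add] at hr ⊢
        linear_combination -hr + H 1 x * hs
      | succ n =>
        simp only [Nat.add_sub_cancel] at hr ⊢
        push_cast at hr ⊢
        field_simp
        rw [pow_succ (-Real.sqrt q) (n + 1), pow_succ (-Real.sqrt q) n]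
        linear_combination (-Real.sqrt q) ^ n * Real.sqrt q * hr +
          (-Real.sqrt q) ^ n * (-Real.sqrt q) * (n + 1 + 1) * H (n + 1 + 1) x * hs

/-! ### Orthonormality with respect to Geo(`q`) -/

theorem integral_choose {q : ℝ} (h0 : 0 < q) (h1 : q < 1) (k : ℕ) :
    Integrable (fun x : ℕ => (x.choose k : ℝ)) (geo q) ∧
    ∫ x : ℕ, (x.choose k : ℝ) ∂(geo q) = (q / (1 - q)) ^ k := by
  have hn : ‖q‖ < 1 := by rw [Real.norm_eq_abs, abs_of_pos h0]; exact h1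
  have hsum := hasSum_choose_mul_geometric_of_norm_lt_one k hn
  have hs2 : HasSum (fun x : ℕ => (x.choose k : ℝ) * q ^ x) (q ^ k * (1 / (1 - q) ^ (k + 1))) := by
    rw [← hasSum_nat_add_iff' k]
    have : ∑ i ∈ Finset.range k, (i.choose k : ℝ) * q ^ i = 0 :=
      Finset.sum_eq_zero fun i hi => by
        rw [Nat.choose_eq_zero_of_lt (Finset.mem_range.1 hi)]; simp
    rw [this, sub_zero]
    refine (hsum.mul_left (q ^ k)).congr_fun ?_ |> id
    intro x
    rw [pow_add]; ring
  have hint : Integrable (fun x : ℕ => (x.choose k : ℝ)) (geo q) := by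
    unfold geo
    rw [integrable_geometricMeasure_iff (projIcc_ne_zero h0 h1), coe_projIcc h0 h1]
    refine (hs2.summable.mul_left (1 - q)).congr fun x => ?_
    rw [Real.norm_of_nonneg (by positivity)]
    ring
  refine ⟨hint, ?_⟩
  unfold geo
  rw [integral_geometricMeasure (projIcc_ne_zero h0 h1), coe_projIcc h0 h1]
  have : HasSum (fun x : ℕ => ((1 - (1 - q)) ^ x * (1 - q)) • (x.choose k : ℝ))
      ((1 - q) * (q ^ k * (1 / (1 - q) ^ (k + 1)))) := by
    refine (hs2.mul_left (1 - q)).congr_fun ?_ |> id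
    intro x
    simp only [smul_eq_mul]
    ring
  rw [this.tsum_eq, div_pow, pow_succ]
  have : 1 - q ≠ 0 := by linarith
  field_simp

/-- Integrating the hypergeometric sum termwise gives `∑ (-1)^k n.choose k = (1 - 1)^n`, since `(1 -
1/q) · q/(1 - q) = -1`. -/
theorem ip_one_jacobiPoly {q : ℝ} (h0 : 0 < q) (h1 : q < 1) (n : ℕ) :
    ip q 1 (jacobiPoly q n) = if n = 0 then 1 else 0 := by
  unfold ip
  simp only [eval_one, one_mul, jacobiPoly_eval h0 h1]
  rw [integral_const_mul]
  unfold hyperSum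
  rw [integral_finsetSum _ (fun k _ => by
    have := ((integral_choose h0 h1 k).1.const_mul ((n.choose k : ℝ) * (1 - 1 / q) ^ k))
    refine this.congr (ae_of_all _ fun x => ?_)
    ring)]
  have hk : ∀ k : ℕ, ∫ x : ℕ, (n.choose k : ℝ) * (x.choose k : ℝ) * (1 - 1 / q) ^ k ∂(geo q) =
      (-1) ^ k * 1 ^ (n - k) * (n.choose k : ℝ) := by
    intro k
    have : ∀ x : ℕ, (n.choose k : ℝ) * (x.choose k : ℝ) * (1 - 1 / q) ^ k =
      ((n.choose k : ℝ) * (1 - 1 / q) ^ k) * (x.choose k : ℝ) := fun x => by ring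
    simp only [this]
    rw [integral_const_mul, (integral_choose h0 h1 k).2, mul_assoc, ← mul_pow]
    have : (1 - 1 / q) * (q / (1 - q)) = -1 := by
      have : 1 - q ≠ 0 := by linarith
      field_simp
      ring
    rw [this]; ring
  simp only [hk]
  rw [← add_pow]
  cases n <;> simp

theorem ip_add {q : ℝ} (h0 : 0 < q) (h1 : q < 1) (f g h : ℝ[X]) :
    ip q (f + g) h = ip q f h + ip q g h := by
  unfold ip
  rw [← integral_add (integrable_mul h0 h1 f h) (integrable_mul h0 h1 g h)]
  simp only [eval_add, add_mul]

theorem ip_X_mul (q : ℝ) (f g : ℝ[X]) : ip q (X * f) g = ip q f (X * g) := by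
  unfold ip
  congr 1
  ext x
  simp
  ring

theorem X_mul_jacobiPoly {q : ℝ} (h0 : 0 < q) (h1 : q < 1) (n : ℕ) :
    X * jacobiPoly q n = C (offCoeff q (n + 1)) * jacobiPoly q (n + 1) +
      C (diagCoeff q n) * jacobiPoly q n + C (offCoeff q n) * jacobiPoly q (n - 1) := by
  rw [jacobiPoly_succ h0 h1]; ring

theorem ip_X_mul_jacobiPoly {q : ℝ} (h0 : 0 < q) (h1 : q < 1) (n : ℕ) (g : ℝ[X]) :
    ip q (X * jacobiPoly q n) g = offCoeff q (n + 1) * ip q (jacobiPoly q (n + 1)) g +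
      diagCoeff q n * ip q (jacobiPoly q n) g + offCoeff q n * ip q (jacobiPoly q (n - 1)) g := by
  rw [X_mul_jacobiPoly h0 h1, ip_add h0 h1, ip_add h0 h1, ip_C_mul, ip_C_mul, ip_C_mul]

/-- Only row `0` needs the measure. Multiplication by `X` is symmetric, so expanding `⟨X p_m, p_n⟩ =
⟨p_m, X p_n⟩` by the recurrence determines row `m + 1` from the earlier rows. -/
theorem jacobiPoly_orthonormal {q : ℝ} (h0 : 0 < q) (h1 : q < 1) (m : ℕ) :
    ∀ n, ip q (jacobiPoly q m) (jacobiPoly q n) = if m = n then 1 else 0 := by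
  induction m using Nat.strong_induction_on with
  | _ m ih =>
    match m, ih with
    | 0, _ =>
      intro n
      rw [show jacobiPoly q 0 = 1 from rfl, ip_one_jacobiPoly h0 h1]
      simp [eq_comm]
    | m + 1, ih =>
      intro n
      have hL := ip_X_mul_jacobiPoly h0 h1 m (jacobiPoly q n)
      have hR := ip_X_mul_jacobiPoly h0 h1 n (jacobiPoly q m)
      rw [ip_X_mul, ip_comm] at hL
      rw [hL, ip_comm q (jacobiPoly q (n + 1)), ip_comm q (jacobiPoly q n) (jacobiPoly q m),
        ip_comm q (jacobiPoly q (n - 1)), ih m (by omega), ih m (by omega), ih m (by omega)] at hR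
      have hm1 : offCoeff q m * ip q (jacobiPoly q (m - 1)) (jacobiPoly q n) =
          offCoeff q m * if m - 1 = n then 1 else 0 := by
        cases m with
        | zero => simp [offCoeff_zero]
        | succ m => rw [ih (m + 1 - 1) (by omega)]
      rw [hm1] at hR
      apply mul_left_cancel₀ (offCoeff_pos h0 h1 m).ne'
      have key : offCoeff q (m + 1) * ip q (jacobiPoly q (m + 1)) (jacobiPoly q n) =
          (offCoeff q (n + 1) * if m = n + 1 then 1 else 0) +
          (offCoeff q n * if m = n - 1 then 1 else 0) -
          offCoeff q m * if m - 1 = n then 1 else 0 := by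
        have : (diagCoeff q m * if m = n then (1:ℝ) else 0) = diagCoeff q n * if m = n then 1 else 0 := by
          split_ifs with h
          · rw [h]
          · simp
        linear_combination hR - this
      rw [key]
      by_cases c1 : m = n + 1
      · subst c1
        simp [show ¬ n + 1 = n - 1 by omega, show ¬ n + 1 + 1 = n by omega]
      · by_cases c2 : m + 1 = n
        · subst c2
          simp [show ¬ m - 1 = m + 1 by omega, c1]
        · have : (offCoeff q n * if m = n - 1 then (1:ℝ) else 0) = offCoeff q m * if m - 1 = n then 1 else 0 := by
            by_cases hn : n = 0
            · subst hn
              by_cases hm : m = 0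
              · subst hm; simp
              · simp [hm, show ¬ m - 1 = 0 by omega]
            · rw [if_neg (by omega)]
              by_cases hm : m = 0
              · subst hm; simp [offCoeff_zero]
              · rw [if_neg (by omega)]; simp
          rw [this]
          simp [c1, c2]

/-! ### Identification with the Gram-Schmidt polynomials -/

theorem ip_eq_zero_of_degree_lt {q : ℝ} (h0 : 0 < q) (h1 : q < 1) {p : ℕ → ℝ[X]}
    (hp : ∀ k, (p k).natDegree = k ∧ 0 < (p k).leadingCoeff) {g : ℝ[X]} {n : ℕ}
    (hg : ∀ k < n, ip q (p k) g = 0) :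
    ∀ m, ∀ f : ℝ[X], f.natDegree = m → m < n → ip q f g = 0 := by
  intro m
  induction m using Nat.strong_induction_on with
  | _ m ih =>
    intro f hf hm
    set a := f.leadingCoeff / (p m).leadingCoeff with ha
    have hpm := hp m
    have e : f = (f - C a * p m) + C a * p m := by ring
    rw [e, ip_add h0 h1, ip_C_mul, hg m hm, mul_zero, add_zero]
    rcases Nat.eq_zero_or_pos m with h | h
    · have : f - C a * p m = 0 := by
        subst h
        rw [eq_C_of_natDegree_eq_zero hf, eq_C_of_natDegree_eq_zero hpm.1, ← C_mul, ← C_sub]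
        have e1 : f.leadingCoeff = f.coeff 0 := by unfold leadingCoeff; rw [hf]
        have e2 : (p 0).leadingCoeff = (p 0).coeff 0 := by unfold leadingCoeff; rw [hpm.1]
        rw [ha, e1, e2, div_mul_cancel₀ _ (by rw [← e2]; exact hpm.2.ne')]
        simp
      rw [this]
      simp [ip]
    · by_cases hz : f - C a * p m = 0
      · rw [hz]; simp [ip]
      have hlt : (f - C a * p m).natDegree < m := by
        have hle : (f - C a * p m).natDegree ≤ m :=
          (natDegree_sub_le _ _).trans (max_le hf.le ((natDegree_C_mul_le _ _).trans hpm.1.le))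
        refine lt_of_le_of_ne hle fun heq => ?_
        apply leadingCoeff_ne_zero.2 hz
        unfold leadingCoeff
        rw [heq, coeff_sub, coeff_C_mul]
        have e1 : f.leadingCoeff = f.coeff m := by unfold leadingCoeff; rw [hf]
        have e2 : (p m).leadingCoeff = (p m).coeff m := by unfold leadingCoeff; rw [hpm.1]
        rw [ha, e1, e2, div_mul_cancel₀ _ (by rw [← e2]; exact hpm.2.ne')]
        simp
      exact ih _ hlt _ rfl (hlt.trans hm)

/-- With `a` the ratio of leading coefficients, the difference `M q n - C a * jacobiPoly q n`, if
nonzero, has degree below `n` and is orthogonal to all such polynomials, hence to itself.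
Normalisation and positivity give `a = 1`. -/
theorem M_eq_jacobiPoly {q : ℝ} (h0 : 0 < q) (h1 : q < 1) (n : ℕ) : M q n = jacobiPoly q n := by
  obtain ⟨hd, hl⟩ := jacobiPoly_degree_lc h0 h1 n
  obtain ⟨hd', hl'⟩ := M_natDegree_leadingCoeff h0 h1 n
  set a := (M q n).leadingCoeff / (jacobiPoly q n).leadingCoeff with ha
  have hapos : 0 < a := div_pos hl' hl
  have hM : ∀ f : ℝ[X], f.natDegree < n → ip q f (M q n) = 0 := fun f hf =>
    ip_eq_zero_of_degree_lt h0 h1 (M_natDegree_leadingCoeff h0 h1) (g := M q n) (n := n)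
      (fun k hk => by rw [M_orthonormal h0 h1, if_neg hk.ne]) _ f rfl hf
  have hJ : ∀ f : ℝ[X], f.natDegree < n → ip q f (jacobiPoly q n) = 0 := fun f hf =>
    ip_eq_zero_of_degree_lt h0 h1 (M_natDegree_leadingCoeff h0 h1) (g := jacobiPoly q n) (n := n)
      (fun k hk => by
        refine ip_eq_zero_of_degree_lt h0 h1 (jacobiPoly_degree_lc h0 h1) (n := n)
          (fun i hi => by rw [jacobiPoly_orthonormal h0 h1, if_neg hi.ne]) _ (M q k) rfl ?_
        rwa [(M_natDegree_leadingCoeff h0 h1 k).1]) _ f rfl hf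
  have hz : M q n - C a * jacobiPoly q n = 0 := by
    by_contra hne
    have hn : n ≠ 0 := by
      rintro rfl
      apply hne
      have e1 : (M q 0).leadingCoeff = (M q 0).coeff 0 := by unfold leadingCoeff; rw [hd']
      have e2 : (jacobiPoly q 0).leadingCoeff = (jacobiPoly q 0).coeff 0 := by
        unfold leadingCoeff; rw [hd]
      rw [eq_C_of_natDegree_eq_zero hd', eq_C_of_natDegree_eq_zero hd, ← C_mul, ← C_sub, ha, e1, e2,
        div_mul_cancel₀ _ (by rw [← e2]; exact hl.ne')]
      simp
    have hlt : (M q n - C a * jacobiPoly q n).natDegree < n := by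
      have hle : (M q n - C a * jacobiPoly q n).natDegree ≤ n :=
        (natDegree_sub_le _ _).trans (max_le hd'.le ((natDegree_C_mul_le _ _).trans hd.le))
      refine lt_of_le_of_ne hle fun heq => ?_
      apply leadingCoeff_ne_zero.2 hne
      unfold leadingCoeff
      rw [heq, coeff_sub, coeff_C_mul]
      have e1 : (M q n).leadingCoeff = (M q n).coeff n := by unfold leadingCoeff; rw [hd']
      have e2 : (jacobiPoly q n).leadingCoeff = (jacobiPoly q n).coeff n := by
        unfold leadingCoeff; rw [hd]
      rw [ha, e1, e2, div_mul_cancel₀ _ (by rw [← e2]; exact hl.ne')]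
      simp
    have := ip_self_pos h0 h1 hne
    rw [ip_sub h0 h1 _ _ (M q n - C a * jacobiPoly q n), ip_C_mul, ip_comm, hM _ hlt,
      ip_comm, hJ _ hlt] at this
    simp at this
  have he : M q n = C a * jacobiPoly q n := sub_eq_zero.1 hz
  have h1' : a * a = 1 := by
    have := M_orthonormal h0 h1 n n
    rw [he, ip_C_mul, ip_comm, ip_C_mul, jacobiPoly_orthonormal h0 h1] at this
    simpa using this
  have : a = 1 := by nlinarith
  rw [he, this]; simp

/-! ### Recurrence and Christoffel-Darboux formula -/

/-- The three-term recurrence. -/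
theorem M_recurrence {q : ℝ} (h0 : 0 < q) (h1 : q < 1) (n : ℕ) :
    X * M q n = C (offCoeff q (n + 1)) * M q (n + 1) +
      C (diagCoeff q n) * M q n + C (offCoeff q n) * M q (n - 1) := by
  simp only [M_eq_jacobiPoly h0 h1]
  exact X_mul_jacobiPoly h0 h1 n

theorem M_zero {q : ℝ} (h0 : 0 < q) (h1 : q < 1) : M q 0 = 1 := by
  rw [M_eq_jacobiPoly h0 h1]; rfl

/-- The confluent Christoffel-Darboux formula. -/
theorem christoffelDarboux {q : ℝ} (h0 : 0 < q) (h1 : q < 1) (N : ℕ) :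
    C (offCoeff q N) * ((M q N).derivative * M q (N - 1) - (M q (N - 1)).derivative * M q N) =
      ∑ n ∈ Finset.range N, M q n ^ 2 := by
  induction N with
  | zero => simp [offCoeff_zero]
  | succ n ih =>
    rw [Finset.sum_range_succ, ← ih]
    have h := M_recurrence h0 h1 n
    have hd := congrArg Polynomial.derivative h
    simp only [derivative_mul, derivative_add, derivative_X, derivative_C, zero_mul, zero_add,
      one_mul] at hd
    simp only [Nat.add_sub_cancel]
    -- The terms in `X` and `diagCoeff` cancel, leaving the increment `M_n²` of a telescoping sum.
    linear_combination (M q n).derivative * h - M q n * hd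

theorem kernel_self {q : ℝ} (h0 : 0 < q) (h1 : q < 1) {N : ℕ} (hN : 1 ≤ N) (x : ℕ) :
    kernel q N x x = ∑ n ∈ Finset.range N, (M q n).eval (x : ℝ) ^ 2 := by
  have h := congrArg (Polynomial.eval (x : ℝ)) (christoffelDarboux h0 h1 N)
  simp only [eval_mul, eval_C, eval_sub, eval_finsetSum, eval_pow] at h
  have hb : (M q (N - 1)).leadingCoeff / (M q N).leadingCoeff = offCoeff q N := by
    obtain ⟨n, rfl⟩ : ∃ n, N = n + 1 := ⟨N - 1, by omega⟩
    rw [div_eq_iff (M_natDegree_leadingCoeff h0 h1 _).2.ne', M_eq_jacobiPoly h0 h1,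
      M_eq_jacobiPoly h0 h1, offCoeff_mul_leadingCoeff h0 h1]
    simp
  unfold kernel
  rw [if_pos rfl, hb, h]

/-! ### A bump sequence -/

/-- A bump supported on `a, …, a + 4 j`, vanishing to second order at both ends. -/
noncomputable def bump (j a n : ℕ) : ℝ :=
  if a ≤ n ∧ n ≤ a + 4 * j then (((n : ℝ) - a) * (a + 4 * j - n)) ^ 2 else 0

theorem bump_of_mem {j a n : ℕ} (h1 : a ≤ n) (h2 : n ≤ a + 4 * j) :
    bump j a n = (((n : ℝ) - a) * (a + 4 * j - n)) ^ 2 := if_pos ⟨h1, h2⟩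

theorem bump_of_le {j a n : ℕ} (h : n ≤ a) : bump j a n = 0 := by
  unfold bump
  split_ifs with h'
  · rw [show n = a by omega]; simp
  · rfl

theorem bump_of_ge {j a n : ℕ} (h : a + 4 * j ≤ n) : bump j a n = 0 := by
  unfold bump
  split_ifs with h'
  · rw [show n = a + 4 * j by omega]; simp
  · rfl

theorem bump_nonneg (j a n : ℕ) : 0 ≤ bump j a n := by
  unfold bump
  split_ifs
  · positivity
  · rfl

theorem bump_le (j a n : ℕ) : bump j a n ≤ 16 * (j : ℝ) ^ 4 := by
  unfold bump
  split_ifs with h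
  · have h1 : (a : ℝ) ≤ n := by exact_mod_cast h.1
    have h2 : (n : ℝ) ≤ a + 4 * j := by exact_mod_cast h.2
    have h3 : 0 ≤ ((n : ℝ) - a) * (a + 4 * j - n) :=
      mul_nonneg (by linarith) (by linarith)
    have h4 : ((n : ℝ) - a) * (a + 4 * j - n) ≤ 4 * (j : ℝ) ^ 2 := by
      nlinarith [sq_nonneg ((n : ℝ) - a - 2 * j)]
    calc _ ≤ (4 * (j : ℝ) ^ 2) ^ 2 := pow_le_pow_left₀ h3 h4 2
      _ = _ := by ring
  · positivity

theorem bump_ge {j a n : ℕ} (h1 : a + j ≤ n) (h2 : n ≤ a + 3 * j) :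
    9 * (j : ℝ) ^ 4 ≤ bump j a n := by
  rw [bump_of_mem (by omega) (by omega)]
  have h3 : (a : ℝ) + j ≤ n := by exact_mod_cast h1
  have h4 : (n : ℝ) ≤ a + 3 * j := by exact_mod_cast h2
  have h5 : 3 * (j : ℝ) ^ 2 ≤ ((n : ℝ) - a) * (a + 4 * j - n) := by
    nlinarith [mul_nonneg (sub_nonneg.2 h3) (sub_nonneg.2 h4)]
  calc _ = (3 * (j : ℝ) ^ 2) ^ 2 := by ring
    _ ≤ _ := pow_le_pow_left₀ (by positivity) h5 2

theorem abs_bump_sub_le (j a n : ℕ) : |bump j a (n + 1) - bump j a n| ≤ 32 * (j : ℝ) ^ 3 := by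
  rcases le_or_gt (n + 1) a with h | h
  · rw [bump_of_le h, bump_of_le (by omega)]; simp
  rcases le_or_gt (a + 4 * j) n with h' | h'
  · rw [bump_of_ge h', bump_of_ge (by omega)]; simp
  rw [bump_of_mem (by omega) (by omega), bump_of_mem (by omega) (by omega)]
  have h1 : (a : ℝ) ≤ n := by exact_mod_cast (by omega : a ≤ n)
  have h2 : (n : ℝ) + 1 ≤ a + 4 * j := by exact_mod_cast (by omega : n + 1 ≤ a + 4 * j)
  push_cast
  set y : ℝ := n - a with hy
  have e : (((n : ℝ) + 1 - a) * (a + 4 * j - (n + 1))) ^ 2 - ((n - a) * (a + 4 * j - n)) ^ 2 =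
      (4 * j - 1 - 2 * y) * ((y + 1) * (4 * j - (y + 1)) + y * (4 * j - y)) := by
    rw [hy]; ring
  rw [e, abs_mul]
  have f1 : |4 * (j : ℝ) - 1 - 2 * y| ≤ 4 * j := abs_le.2 ⟨by linarith, by linarith⟩
  have f2 : |(y + 1) * (4 * (j : ℝ) - (y + 1)) + y * (4 * j - y)| ≤ 8 * (j : ℝ) ^ 2 := by
    rw [abs_of_nonneg (add_nonneg (mul_nonneg (by linarith) (by linarith))
      (mul_nonneg (by linarith) (by linarith)))]
    nlinarith [sq_nonneg (y - 2 * j), sq_nonneg (y + 1 - 2 * j)]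
  calc _ ≤ (4 * (j : ℝ)) * (8 * (j : ℝ) ^ 2) :=
        mul_le_mul f1 f2 (abs_nonneg _) (by positivity)
    _ = _ := by ring

/-- Squaring the parabola makes its zeros at the ends double, so the cut-off keeps second
differences of order `j²` against values of order `j⁴`. The two positions where the stencil
straddles an end have a single nonzero entry and are treated apart. -/
theorem abs_bump_second_le {j : ℕ} (hj : 1 ≤ j) (a n : ℕ) :
    |bump j a (n + 2) - 2 * bump j a (n + 1) + bump j a n| ≤ 80 * (j : ℝ) ^ 2 := by
  have hj' : (1 : ℝ) ≤ j := by exact_mod_cast hj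
  have hjj : (0 : ℝ) ≤ (j : ℝ) ^ 2 := by positivity
  have edge : (1 * (4 * (j : ℝ) - 1)) ^ 2 ≤ 80 * (j : ℝ) ^ 2 := by nlinarith
  rcases le_or_gt (n + 2) a with h | h
  · rw [bump_of_le h, bump_of_le (by omega), bump_of_le (by omega)]; simp
  rcases le_or_gt (a + 4 * j) n with h' | h'
  · rw [bump_of_ge h', bump_of_ge (by omega), bump_of_ge (by omega)]; simp
  rcases eq_or_ne (n + 1) a with h1 | h1
  · rw [bump_of_le (n := n) (by omega), bump_of_le (n := n + 1) (by omega),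
      bump_of_mem (by omega) (by omega), ← h1]
    push_cast
    have e : ((n : ℝ) + 2 - (n + 1)) * (n + 1 + 4 * j - (n + 2)) = 1 * (4 * j - 1) := by ring
    rw [e, mul_zero, sub_zero, add_zero, abs_of_nonneg (sq_nonneg _)]
    exact edge
  rcases eq_or_ne (n + 1) (a + 4 * j) with h2 | h2
  · rw [bump_of_ge (n := n + 2) (by omega), bump_of_ge (n := n + 1) (by omega),
      bump_of_mem (by omega) (by omega)]
    have h3 : (n : ℝ) + 1 = a + 4 * j := by exact_mod_cast h2
    have e : ((n : ℝ) - a) * (a + 4 * j - n) = 1 * (4 * j - 1) := by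
      rw [show (n : ℝ) = a + 4 * j - 1 by linarith]; ring
    rw [e, mul_zero, sub_zero, zero_add, abs_of_nonneg (sq_nonneg _)]
    exact edge
  rw [bump_of_mem (by omega) (by omega), bump_of_mem (by omega) (by omega),
    bump_of_mem (by omega) (by omega)]
  have h3 : (a : ℝ) ≤ n := by exact_mod_cast (by omega : a ≤ n)
  have h4 : (n : ℝ) + 2 ≤ a + 4 * j := by exact_mod_cast (by omega : n + 2 ≤ a + 4 * j)
  push_cast
  set d : ℝ := 4 * j - 2 * (n + 1 - a) with hd
  have e : (((n : ℝ) + 2 - a) * (a + 4 * j - (n + 2))) ^ 2 -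
      2 * ((n + 1 - a) * (a + 4 * j - (n + 1))) ^ 2 + ((n - a) * (a + 4 * j - n)) ^ 2 =
      3 * d ^ 2 + 2 - 16 * j ^ 2 := by rw [hd]; ring
  rw [e]
  have f1 : d ^ 2 ≤ (4 * (j : ℝ)) ^ 2 := sq_le_sq' (by linarith) (by linarith)
  rw [abs_le]
  constructor <;> nlinarith [sq_nonneg d]

theorem sum_bump_sq_ge (j a : ℕ) {R : ℕ} (hR : a + 4 * j ≤ R) :
    162 * (j : ℝ) ^ 9 ≤ ∑ n ∈ Finset.range R, bump j a n ^ 2 := by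
  have hsub : Finset.Ico (a + j) (a + 3 * j) ⊆ Finset.range R := by
    intro n; simp only [Finset.mem_Ico, Finset.mem_range]; omega
  calc 162 * (j : ℝ) ^ 9 = ∑ n ∈ Finset.Ico (a + j) (a + 3 * j), (9 * (j : ℝ) ^ 4) ^ 2 := by
        rw [Finset.sum_const, Nat.card_Ico, show a + 3 * j - (a + j) = 2 * j by omega, nsmul_eq_mul]
        push_cast; ring
    _ ≤ ∑ n ∈ Finset.Ico (a + j) (a + 3 * j), bump j a n ^ 2 := by
        refine Finset.sum_le_sum fun n hn => ?_
        rw [Finset.mem_Ico] at hn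
        exact pow_le_pow_left₀ (by positivity) (bump_ge hn.1 (by omega)) 2
    _ ≤ _ := Finset.sum_le_sum_of_subset_of_nonneg hsub fun _ _ _ => sq_nonneg _

/-! ### Polynomials in the orthonormal basis -/

theorem ip_combination {q : ℝ} (h0 : 0 < q) (h1 : q < 1) (R : ℕ) (c d : ℕ → ℝ) :
    ip q (∑ n ∈ Finset.range R, C (c n) * M q n) (∑ n ∈ Finset.range R, C (d n) * M q n) =
      ∑ n ∈ Finset.range R, c n * d n := by
  rw [ip_sum h0 h1]
  refine Finset.sum_congr rfl fun n hn => ?_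
  rw [ip_C_mul, ip_comm, ip_sum h0 h1, Finset.sum_eq_single n]
  · rw [ip_C_mul, M_orthonormal h0 h1]; simp
  · intro k _ hk
    rw [ip_C_mul, M_orthonormal h0 h1, if_neg hk, mul_zero]
  · exact fun h => absurd hn h

/-- On coefficients, `X` acts as the Jacobi matrix. Vanishing from index `R` on ensures that nothing
leaves the range at the top. -/
theorem X_mul_combination {q : ℝ} (h0 : 0 < q) (h1 : q < 1) (R : ℕ) (c : ℕ → ℝ)
    (hc : ∀ n, R ≤ n → c n = 0) :
    X * ∑ n ∈ Finset.range (R + 1), C (c n) * M q n =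
      ∑ n ∈ Finset.range (R + 1), C (offCoeff q (n + 1) * c (n + 1) + diagCoeff q n * c n +
        offCoeff q n * c (n - 1)) * M q n := by
  have e1 : ∑ n ∈ Finset.range (R + 1), C (c n * offCoeff q (n + 1)) * M q (n + 1) =
      ∑ n ∈ Finset.range (R + 1), C (offCoeff q n * c (n - 1)) * M q n := by
    rw [Finset.sum_range_succ, hc R le_rfl, Finset.sum_range_succ' _ R, offCoeff_zero]
    simp [mul_comm]
  have e2 : ∑ n ∈ Finset.range (R + 1), C (c n * offCoeff q n) * M q (n - 1) =
      ∑ n ∈ Finset.range (R + 1), C (offCoeff q (n + 1) * c (n + 1)) * M q n := by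
    rw [Finset.sum_range_succ', Finset.sum_range_succ, hc (R + 1) (by omega), offCoeff_zero]
    simp [mul_comm]
  simp only [C_add, add_mul, Finset.sum_add_distrib]
  rw [← e1, ← e2, Finset.mul_sum, add_right_comm, ← Finset.sum_add_distrib,
    ← Finset.sum_add_distrib]
  have h := fun n => M_recurrence h0 h1 n
  refine Finset.sum_congr rfl fun n _ => ?_
  rw [mul_left_comm, h n]
  simp only [C_mul]
  ring

/-- Integrated form of `y ≤ K 1_{0 ≤ y ≤ K} + y ^ 2 / K` for `y = x - T`. -/
theorem ip_le_sum {q : ℝ} (h0 : 0 < q) (h1 : q < 1) (F : ℝ[X]) {T K : ℝ} (hK : 0 < K)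
    (S : Finset ℕ) (hS : ∀ x : ℕ, T ≤ x → (x : ℝ) ≤ T + K → x ∈ S) :
    ip q ((X - C T) * F) F ≤ K * ∑ x ∈ S, (geo q).real {x} * F.eval (x : ℝ) ^ 2 +
      ip q ((X - C T) * F) ((X - C T) * F) / K := by
  have hsum : ∑ x ∈ S, (geo q).real {x} * F.eval (x : ℝ) ^ 2 =
      ∫ x : ℕ in (S : Set ℕ), F.eval (x : ℝ) ^ 2 ∂(geo q) := by
    rw [setIntegral_finset]
    · simp
    · have := integrable_poly h0 h1 (F ^ 2)
      simp only [eval_pow] at this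
      exact this.integrableOn
  have hF : Integrable (fun x : ℕ => F.eval (x : ℝ) ^ 2) (geo q) := by
    have := integrable_poly h0 h1 (F ^ 2)
    simpa only [eval_pow] using this
  rw [hsum, ← integral_indicator (MeasurableSet.of_discrete), ← integral_const_mul]
  unfold ip
  rw [← integral_div, ← integral_add]
  · refine integral_mono (integrable_mul h0 h1 _ _) ?_ ?_
    · exact ((hF.indicator MeasurableSet.of_discrete).const_mul K).add
        ((integrable_mul h0 h1 _ _).div_const K)
    · intro x
      simp only [eval_mul, eval_sub, eval_X, eval_C]
      set y : ℝ := x - T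
      set f := F.eval (x : ℝ)
      have e : y * f * (y * f) / K = y ^ 2 / K * f ^ 2 := by ring
      rw [e, show y * f * f = y * f ^ 2 by ring]
      by_cases hx : x ∈ S
      · rw [Set.indicator_of_mem (by simpa using hx)]
        have : y ≤ K + y ^ 2 / K := by
          rw [← sub_nonneg, show K + y ^ 2 / K - y = ((K - y / 2) ^ 2 + 3 / 4 * y ^ 2) / K by
            field_simp; ring]
          positivity
        nlinarith [mul_le_mul_of_nonneg_right this (sq_nonneg f)]
      · rw [Set.indicator_of_notMem (by simpa using hx), mul_zero, zero_add]
        refine mul_le_mul_of_nonneg_right ?_ (sq_nonneg f)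
        rcases lt_or_ge y 0 with hy | hy
        · exact hy.le.trans (by positivity)
        · have : K < y := by
            by_contra! hle
            exact hx (hS x (by simpa [y] using hy) (by simp only [y] at hle; linarith))
          rw [le_div_iff₀ hK]
          nlinarith
  · exact (hF.indicator MeasurableSet.of_discrete).const_mul K
  · exact (integrable_mul h0 h1 _ _).div_const K

/-! ### Mass near the edge carried by a window of degrees -/

/-- The constant term `√q / (1 - √q)` of `a_n + b_n + b_{n+1} = μ_q n + √q / (1 - √q)`. -/
noncomputable def edgeShift (q : ℝ) : ℝ := (q + Real.sqrt q) / (1 - q)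

theorem edge_mul_add_edgeShift {q : ℝ} (h0 : 0 < q) (n : ℕ) :
    edge q * n + edgeShift q = diagCoeff q n + offCoeff q n + offCoeff q (n + 1) := by
  have hs := Real.sq_sqrt h0.le
  unfold edge edgeShift diagCoeff offCoeff
  push_cast
  rw [add_sq, hs]
  ring

theorem offCoeff_mono {q : ℝ} (h1 : q < 1) {m n : ℕ} (h : m ≤ n) : offCoeff q m ≤ offCoeff q n := by
  have : 0 < 1 - q := by linarith
  unfold offCoeff
  gcongr

/-- The polynomial with bump coefficients on the window is a test function for `x - T`. The
hypothesis `hV` keeps the potential of order `m`, and `hb` makes the second-order term a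
perturbation that the margin `2 * m` absorbs. -/
theorem window_mass {q : ℝ} (h0 : 0 < q) (h1 : q < 1) {j a : ℕ} (hj : 1 ≤ j) (hja : j ≤ a)
    {T m : ℝ} (hm : 0 < m)
    (hV : ∀ n ∈ Finset.Ico a (a + 4 * j), 2 * m ≤ edge q * n + edgeShift q - T ∧
      edge q * n + edgeShift q - T ≤ 8 * m)
    (hb : 45 * offCoeff q (a + 4 * j + 1) ≤ m * (j : ℝ) ^ 2)
    (S : Finset ℕ) (hS : ∀ x : ℕ, T ≤ x → (x : ℝ) ≤ T + 258 * m → x ∈ S) :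
    1 / 516 ≤ ∑ x ∈ S, (geo q).real {x} *
      ∑ n ∈ Finset.Ico a (a + 4 * j), (M q n).eval (x : ℝ) ^ 2 := by
  set c := bump j a with hc
  set R := a + 4 * j + 1 with hR
  set b := offCoeff q R with hbdef
  have hjr : (1 : ℝ) ≤ j := by exact_mod_cast hj
  have hj0 : (0 : ℝ) < j := by linarith
  set F : ℝ[X] := ∑ n ∈ Finset.range (R + 1), C (c n) * M q n with hF
  -- The part of the Jacobi matrix left after removing the potential is in divergence form, so it
  -- sees only differences of the bump.
  set e : ℕ → ℝ := fun n => offCoeff q (n + 1) * (c (n + 1) - c n) - offCoeff q n * (c n - c (n - 1))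
    with he
  set V : ℕ → ℝ := fun n => edge q * n + edgeShift q - T with hVdef
  have hXF : (X - C T) * F = ∑ n ∈ Finset.range (R + 1), C (V n * c n + e n) * M q n := by
    rw [sub_mul, hF, X_mul_combination h0 h1 R c (fun n hn => bump_of_ge (by omega)),
      Finset.mul_sum, ← Finset.sum_sub_distrib]
    refine Finset.sum_congr rfl fun n _ => ?_
    rw [← mul_assoc, ← C_mul, ← sub_mul, ← C_sub]
    congr 2
    simp only [hVdef, he, edge_mul_add_edgeShift h0]
    ring
  have hE : ∀ n, |e n| ≤ if n ∈ Finset.Icc a (a + 4 * j) then 112 * b * (j : ℝ) ^ 2 else 0 := by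
    intro n
    have hbpos : 0 < b := offCoeff_pos h0 h1 _
    split_ifs with hn
    · rw [Finset.mem_Icc] at hn
      obtain ⟨k, rfl⟩ : ∃ k, n = k + 1 := ⟨n - 1, by omega⟩
      -- As `b_n` is linear in `n`, the divergence is `b` times a second difference (bound 80) plus
      -- the slope of `b` times a first difference (bound 32): 112 in total.
      have e1 : e (k + 1) = offCoeff q (k + 1) * (c (k + 2) - 2 * c (k + 1) + c k) +
          Real.sqrt q / (1 - q) * (c (k + 2) - c (k + 1)) := by
        simp only [he, offCoeff, Nat.add_sub_cancel]
        push_cast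
        ring
      have hq : 0 < 1 - q := by linarith
      have hβ : 0 ≤ Real.sqrt q / (1 - q) := by positivity
      have hβj : Real.sqrt q / (1 - q) * j ≤ b := by
        have := offCoeff_mono h1 (show j ≤ R by omega)
        unfold offCoeff at this
        rw [hbdef]; unfold offCoeff
        calc _ = Real.sqrt q * j / (1 - q) := by ring
          _ ≤ _ := this
      have hbk : offCoeff q (k + 1) ≤ b := offCoeff_mono h1 (by omega)
      rw [e1]
      refine (abs_add_le _ _).trans ?_
      rw [abs_mul, abs_mul, abs_of_nonneg (offCoeff_pos h0 h1 k).le, abs_of_nonneg hβ]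
      have f1 := mul_le_mul hbk (abs_bump_second_le hj a k) (abs_nonneg _) hbpos.le
      have f2 := mul_le_mul_of_nonneg_left (abs_bump_sub_le j a (k + 1)) hβ
      have f3 : Real.sqrt q / (1 - q) * (32 * (j : ℝ) ^ 3) ≤ b * (32 * (j : ℝ) ^ 2) := by
        calc _ = (Real.sqrt q / (1 - q) * j) * (32 * (j : ℝ) ^ 2) := by ring
          _ ≤ _ := by gcongr
      calc _ ≤ b * (80 * (j : ℝ) ^ 2) + b * (32 * (j : ℝ) ^ 2) := by
            refine add_le_add f1 (f2.trans f3)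
        _ = _ := by ring
    · rw [Finset.mem_Icc] at hn
      have : e n = 0 := by
        simp only [he, hc]
        rcases lt_or_ge n a with h | h
        · rw [bump_of_le (n := n + 1) (by omega), bump_of_le (n := n) (by omega),
            bump_of_le (n := n - 1) (by omega)]; ring
        · rw [bump_of_ge (n := n + 1) (by omega), bump_of_ge (n := n) (by omega),
            bump_of_ge (n := n - 1) (by omega)]; ring
      rw [this, abs_zero]
  set E : ℝ := 112 * b * (j : ℝ) ^ 2 with hEdef
  have hEm : E ≤ 2.5 * m * (j : ℝ) ^ 4 := by
    have := mul_le_mul_of_nonneg_right hb (sq_nonneg (j : ℝ))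
    rw [hEdef]
    have hm4 : 0 < m * (j : ℝ) ^ 4 := by positivity
    nlinarith
  have hE0 : 0 ≤ E := by
    have : 0 < b := offCoeff_pos h0 h1 _
    rw [hEdef]; positivity
  set A : ℝ := ∑ n ∈ Finset.range (R + 1), c n ^ 2 with hA
  have hAge : 162 * (j : ℝ) ^ 9 ≤ A := sum_bump_sq_ge j a (by omega)
  have hApos : 0 < A := lt_of_lt_of_le (by positivity) hAge
  have hsubI : Finset.Icc a (a + 4 * j) ⊆ Finset.range (R + 1) := by
    intro n; simp only [Finset.mem_Icc, Finset.mem_range]; omega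
  have hfilter : Finset.range (R + 1) ∩ Finset.Icc a (a + 4 * j) = Finset.Icc a (a + 4 * j) :=
    Finset.inter_eq_right.2 hsubI
  have hcard : ((Finset.Icc a (a + 4 * j)).card : ℝ) ≤ 5 * j := by
    rw [Nat.card_Icc, show a + 4 * j + 1 - a = 4 * j + 1 by omega]
    push_cast; linarith
  have hVn : ∀ n, 2 * m * c n ^ 2 ≤ V n * c n ^ 2 ∧ V n ^ 2 * c n ^ 2 ≤ 64 * m ^ 2 * c n ^ 2 := by
    intro n
    by_cases hn : n ∈ Finset.Ico a (a + 4 * j)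
    · obtain ⟨g1, g2⟩ := hV n hn
      refine ⟨mul_le_mul_of_nonneg_right g1 (sq_nonneg _), mul_le_mul_of_nonneg_right ?_ (sq_nonneg _)⟩
      calc V n ^ 2 ≤ (8 * m) ^ 2 := pow_le_pow_left₀ (le_trans (by positivity) g1) g2 2
        _ = _ := by ring
    · have : c n = 0 := by
        rw [Finset.mem_Ico] at hn
        rcases lt_or_ge n a with h | h
        · exact bump_of_le h.le
        · exact bump_of_ge (by omega)
      rw [this]; simp
  -- The error is at most `4j · 2.5 m j⁴ · 16 j⁴ = 160 m j⁹`, just below `162 m j⁹ ≤ m A`; half of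
  -- `2 m A` survives.
  have hmean : m * A ≤ ip q ((X - C T) * F) F := by
    have hsub : Finset.Ico a (a + 4 * j) ⊆ Finset.range (R + 1) := by
      intro n; simp only [Finset.mem_Ico, Finset.mem_range]; omega
    rw [hXF, hF, ip_combination h0 h1]
    have g1 : ∀ n ∈ Finset.range (R + 1), 2 * m * c n ^ 2 -
        (if n ∈ Finset.Ico a (a + 4 * j) then E * (16 * (j : ℝ) ^ 4) else 0) ≤
        (V n * c n + e n) * c n := by
      intro n _
      have k1 := (hVn n).1
      have k2 := hE n
      have k3 : |e n * c n| ≤ if n ∈ Finset.Ico a (a + 4 * j) then E * (16 * (j : ℝ) ^ 4) else 0 := by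
        split_ifs with h
        · rw [if_pos (Finset.Ico_subset_Icc_self h)] at k2
          rw [abs_mul, abs_of_nonneg (bump_nonneg j a n)]
          exact mul_le_mul k2 (bump_le j a n) (bump_nonneg _ _ _) hE0
        · have : c n = 0 := by
            rw [Finset.mem_Ico] at h
            rcases lt_or_ge n a with h | h
            · exact bump_of_le h.le
            · exact bump_of_ge (by omega)
          rw [this]; simp
      have k4 := neg_abs_le (e n * c n)
      linarith
    refine le_trans ?_ (Finset.sum_le_sum g1)
    rw [Finset.sum_sub_distrib, ← Finset.mul_sum, ← hA, Finset.sum_ite_mem,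
      Finset.inter_eq_right.2 hsub, Finset.sum_const, nsmul_eq_mul, Nat.card_Ico,
      Nat.add_sub_cancel_left]
    have k5 : ((4 * j : ℕ) : ℝ) * (E * (16 * (j : ℝ) ^ 4)) ≤
        ((4 * j : ℕ) : ℝ) * ((2.5 * m * (j : ℝ) ^ 4) * (16 * (j : ℝ) ^ 4)) := by
      gcongr
    have k6 : ((4 * j : ℕ) : ℝ) * ((2.5 * m * (j : ℝ) ^ 4) * (16 * (j : ℝ) ^ 4)) =
        160 * (m * (j : ℝ) ^ 9) := by push_cast; ring
    have k7 := mul_le_mul_of_nonneg_left hAge hm.le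
    have : 0 ≤ m * (j : ℝ) ^ 9 := by positivity
    nlinarith
  have hvar : ip q ((X - C T) * F) ((X - C T) * F) ≤ 129 * m ^ 2 * A := by
    rw [hXF, ip_combination h0 h1]
    have g1 : ∀ n ∈ Finset.range (R + 1), (V n * c n + e n) * (V n * c n + e n) ≤
        128 * m ^ 2 * c n ^ 2 + (if n ∈ Finset.Icc a (a + 4 * j) then 2 * E ^ 2 else 0) := by
      intro n _
      have k1 := (hVn n).2
      have k2 := hE n
      have k3 : 2 * e n ^ 2 ≤ if n ∈ Finset.Icc a (a + 4 * j) then 2 * E ^ 2 else 0 := by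
        rw [← sq_abs]
        split_ifs at k2 ⊢ with h
        · gcongr
        · rw [le_antisymm k2 (abs_nonneg _)]; simp
      nlinarith [sq_nonneg (V n * c n - e n)]
    refine (Finset.sum_le_sum g1).trans ?_
    rw [Finset.sum_add_distrib, ← Finset.mul_sum, ← hA, Finset.sum_ite_mem, hfilter,
      Finset.sum_const, nsmul_eq_mul]
    have k5 : ((Finset.Icc a (a + 4 * j)).card : ℝ) * (2 * E ^ 2) ≤
        (5 * j) * (2 * (2.5 * m * (j : ℝ) ^ 4) ^ 2) := by gcongr
    have k6 : (5 * (j : ℝ)) * (2 * (2.5 * m * (j : ℝ) ^ 4) ^ 2) = 62.5 * m ^ 2 * (j : ℝ) ^ 9 := by ring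
    have k7 := mul_le_mul_of_nonneg_left hAge (sq_nonneg m)
    have : 0 ≤ m ^ 2 * (j : ℝ) ^ 9 := by positivity
    nlinarith
  -- The cut-off `258 m` is twice `129 m`, so the second-moment term uses at most half of the mean.
  have hmain := ip_le_sum h0 h1 F (T := T) (K := 258 * m) (by positivity) S hS
  have hstep : 1 / 516 * A ≤ ∑ x ∈ S, (geo q).real {x} * F.eval (x : ℝ) ^ 2 := by
    have k1 : ip q ((X - C T) * F) ((X - C T) * F) / (258 * m) ≤ m * A / 2 := by
      rw [div_le_iff₀ (by positivity)]
      refine hvar.trans (le_of_eq ?_)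
      ring
    have k2 : m * (A / 2) ≤ m * (258 * ∑ x ∈ S, (geo q).real {x} * F.eval (x : ℝ) ^ 2) := by
      linarith
    have := le_of_mul_le_mul_left k2 hm
    linarith
  have hCS : ∀ x : ℕ, F.eval (x : ℝ) ^ 2 ≤
      A * ∑ n ∈ Finset.Ico a (a + 4 * j), (M q n).eval (x : ℝ) ^ 2 := by
    intro x
    have hsub : Finset.Ico a (a + 4 * j) ⊆ Finset.range (R + 1) := by
      intro n; simp only [Finset.mem_Ico, Finset.mem_range]; omega
    have k1 : F.eval (x : ℝ) = ∑ n ∈ Finset.Ico a (a + 4 * j), c n * (M q n).eval (x : ℝ) := by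
      rw [hF, eval_finsetSum]
      simp only [eval_mul, eval_C]
      refine (Finset.sum_subset hsub fun n _ hn => ?_).symm
      have : c n = 0 := by
        rw [Finset.mem_Ico] at hn
        rcases lt_or_ge n a with h | h
        · exact bump_of_le h.le
        · exact bump_of_ge (by omega)
      rw [this, zero_mul]
    rw [k1]
    refine (Finset.sum_mul_sq_le_sq_mul_sq _ _ _).trans ?_
    refine mul_le_mul_of_nonneg_right ?_ (Finset.sum_nonneg fun _ _ => sq_nonneg _)
    exact Finset.sum_le_sum_of_subset_of_nonneg hsub fun _ _ _ => sq_nonneg _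
  have hfin : A * (1 / 516) ≤ A * ∑ x ∈ S, (geo q).real {x} *
      ∑ n ∈ Finset.Ico a (a + 4 * j), (M q n).eval (x : ℝ) ^ 2 := by
    rw [mul_comm]
    refine hstep.trans ?_
    rw [Finset.mul_sum]
    refine Finset.sum_le_sum fun x _ => ?_
    rw [mul_left_comm]
    exact mul_le_mul_of_nonneg_left (hCS x) measureReal_nonneg
  exact le_of_mul_le_mul_left hfin hApos

/-! ### The mean empirical distribution -/

/-- The expected number of points in `S` of the `N × N` Meixner ensemble. -/
noncomputable def pointMass (q : ℝ) (N : ℕ) (S : Finset ℕ) : ℝ :=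
  ∑ x ∈ S, (geo q).real {x} * ∑ n ∈ Finset.range N, (M q n).eval (x : ℝ) ^ 2

theorem sum_real_eq_kernel {q : ℝ} {N : ℕ} {P : Measure (Fin N → ℕ)}
    (hP : IsMeixnerEnsemble q N P) (x : ℕ) :
    ∑ i, P.real {l | l i = x} = kernel q N x x * (geo q).real {x} := by
  have h := hP.isDeterminantal 1 (fun _ => x)
  simp only [Matrix.det_unique, Matrix.of_apply, Finset.univ_unique, Finset.prod_singleton] at h
  rw [← h]
  refine (Fintype.sum_equiv Equiv.uniqueEmbeddingEquivResult _ _ fun e => ?_).symm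
  congr 1
  ext l
  simp [Equiv.uniqueEmbeddingEquivResult]

/-- The case `r = 1` of the determinantal condition gives the one-point intensity, and a finite set
of sites already gives a lower bound. -/
theorem pointMass_div_le {q : ℝ} (h0 : 0 < q) (h1 : q < 1) {N : ℕ} (hN : 1 ≤ N)
    {P : Measure (Fin N → ℕ)} (hP : IsMeixnerEnsemble q N P) {S : Finset ℕ} {A : Set ℕ}
    (hS : ∀ x ∈ S, x ∈ A) : pointMass q N S / N ≤ (meanEmpirical P).real A := by
  have := hP.isProbabilityMeasure
  rw [measureReal_def, meanEmpirical_apply, ENNReal.toReal_mul,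
    ENNReal.toReal_sum (fun i _ => measure_ne_top _ _), ENNReal.toReal_inv, ENNReal.toReal_natCast,
    div_eq_inv_mul]
  refine mul_le_mul_of_nonneg_left ?_ (by positivity)
  have e : pointMass q N S = ∑ i, ∑ x ∈ S, P.real {l | l i = x} := by
    rw [Finset.sum_comm]
    unfold pointMass
    refine Finset.sum_congr rfl fun x _ => ?_
    rw [sum_real_eq_kernel hP, kernel_self h0 h1 hN, mul_comm]
  rw [e]
  refine Finset.sum_le_sum fun i _ => ?_
  have e2 : ∑ x ∈ S, P.real {l | l i = x} = P.real (⋃ x ∈ S, {l | l i = x}) := by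
    rw [measureReal_biUnion_finset]
    · intro x _ y _ hxy
      refine Set.disjoint_left.2 fun l hl hl' => hxy ?_
      rw [Set.mem_ofPred_eq] at hl hl'
      rw [← hl, ← hl']
    · exact fun _ _ => MeasurableSet.of_discrete
  rw [e2]
  refine measureReal_mono ?_ (measure_ne_top _ _)
  intro l hl
  simp only [Set.mem_iUnion, Set.mem_ofPred_eq, exists_prop] at hl
  obtain ⟨x, hx, rfl⟩ := hl
  exact hS _ hx

/-! ### Many points inside the edge -/

theorem sum_windows (f : ℕ → ℝ) {w N : ℕ} : ∀ W : ℕ, w * W ≤ N →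
    ∑ i ∈ Finset.range W, ∑ n ∈ Finset.Ico (N - w * (i + 1)) (N - w * (i + 1) + w), f n =
      ∑ n ∈ Finset.Ico (N - w * W) N, f n := by
  intro W
  induction W with
  | zero => simp
  | succ W ih =>
    intro h
    have h' : w * W ≤ N := le_trans (Nat.mul_le_mul_left _ (Nat.le_succ _)) h
    have h2 : w * (W + 1) = w * W + w := by ring
    rw [Finset.sum_range_succ, ih h', add_comm, show N - w * (W + 1) + w = N - w * W by omega,
      Finset.sum_Ico_consecutive _ (by omega) (by omega)]

theorem mem_Icc_ceil_floor {T K : ℝ} {x : ℕ} (h1 : T ≤ x) (h2 : (x : ℝ) ≤ T + K) :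
    x ∈ Finset.Icc ⌈T⌉₊ ⌊T + K⌋₊ :=
  Finset.mem_Icc.2 ⟨Nat.ceil_le.2 h1, Nat.le_floor h2⟩

theorem edge_ge {q : ℝ} (h1 : q < 1) : 1 / (1 - q) ≤ edge q := by
  have : 0 < 1 - q := by linarith
  have := Real.sqrt_nonneg q
  unfold edge
  gcongr
  nlinarith

theorem edge_pos {q : ℝ} (h1 : q < 1) : 0 < edge q :=
  lt_of_lt_of_le (by have : 0 < 1 - q := by linarith
                     positivity) (edge_ge h1)

theorem edgeShift_nonneg {q : ℝ} (h0 : 0 < q) (h1 : q < 1) : 0 ≤ edgeShift q := by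
  have : 0 < 1 - q := by linarith
  unfold edgeShift
  positivity

theorem edgeShift_le {q : ℝ} (h0 : 0 < q) (h1 : q < 1) : edgeShift q ≤ edge q := by
  have : 0 < 1 - q := by linarith
  have hs := Real.sq_sqrt h0.le
  have := Real.sqrt_nonneg q
  unfold edge edgeShift
  gcongr
  nlinarith

/-- Degrees between `N - N t / 2` and `N`, where `t = r η²`, have potential above `T` by an amount
between `2 m` and `8 m` with `m = μ N t / 4`. They are cut into disjoint windows, each of which
contributes `1/516`. -/
theorem bulk_mass {r η : ℝ} (hη : 0 < η) (hηr : η ≤ r) (hr : r < 1) (hη2 : η ^ 2 < 1 / 2)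
    {N : ℕ} (hN : 160 ≤ N * η ^ 3) :
    ∃ S : Finset ℕ, (∀ x ∈ S, edge (r ^ 6) * N * (1 - r * η ^ 2) ≤ x) ∧
      N * η ^ 3 / 165120 ≤ pointMass (r ^ 6) N S := by
  have hr0 : 0 < r := hη.trans_le hηr
  have h0 : 0 < r ^ 6 := by positivity
  have h1 : r ^ 6 < 1 := pow_lt_one₀ hr0.le hr (by norm_num)
  have hsqrt : Real.sqrt (r ^ 6) = r ^ 3 := by
    rw [show r ^ 6 = (r ^ 3) ^ 2 by ring, Real.sqrt_sq (by positivity)]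
  have hη1 : η < 1 := hηr.trans_lt hr
  have hη3 : η ^ 3 ≤ 1 := pow_le_one₀ hη.le hη1.le
  have hNr : (160 : ℝ) ≤ N := by
    have : (0 : ℝ) ≤ N := by positivity
    nlinarith
  have hNpos : (0 : ℝ) < N := by linarith
  set q := r ^ 6 with hq
  have h1q : 0 < 1 - q := by linarith
  have hμ := edge_pos h1
  set μ := edge q with hμdef
  set t : ℝ := r * η ^ 2 with ht
  have htpos : 0 < t := by positivity
  have ht1 : t < 1 / 2 := by
    have : t ≤ 1 * η ^ 2 := by rw [ht]; gcongr
    linarith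
  have htη : η ^ 3 ≤ t := by
    rw [ht, show η ^ 3 = η * η ^ 2 by ring]; gcongr
  have hNt : 160 ≤ N * t := hN.trans (by gcongr)
  -- Here `b / m` is of order `(r/η)²`, which fixes the scale; `19² = 361` exceeds the `360`
  -- required by `window_mass`.
  set j : ℕ := ⌈19 * (r / η)⌉₊ with hj
  have hrη : 1 ≤ r / η := (one_le_div hη).2 hηr
  have hj1 : 19 * (r / η) ≤ j := Nat.le_ceil _
  have hj2 : (j : ℝ) ≤ 20 * (r / η) := by
    have := (Nat.ceil_lt_add_one (show 0 ≤ 19 * (r / η) by positivity)).le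
    linarith
  have hjge : (1 : ℝ) ≤ j := by linarith
  have hjnat : 1 ≤ j := by exact_mod_cast hjge
  -- The number of windows of length `4j` in a stretch of `N t / 2` degrees. The quotient is at
  -- least 1, so rounding down costs at most a factor 2.
  set W : ℕ := ⌊N * t / (8 * j)⌋₊ with hW
  have hratio : N * η ^ 3 / 160 ≤ N * t / (8 * j) := by
    rw [div_le_div_iff₀ (by norm_num) (by positivity)]
    have e : N * t * 160 = N * η ^ 3 * (8 * (20 * (r / η))) := by
      rw [ht]; field_simp; norm_num
    rw [e]; gcongr
  have hW1 : (W : ℝ) ≤ N * t / (8 * j) := Nat.floor_le (by positivity)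
  have hW2 : N * η ^ 3 / 320 ≤ W := by
    have hlt := Nat.lt_floor_add_one (N * t / (8 * j))
    have hW0 : 1 ≤ W := Nat.le_floor (by push_cast; linarith)
    have hW0' : (1 : ℝ) ≤ W := by exact_mod_cast hW0
    rw [← hW] at hlt
    linarith
  have hjW : (4 * j * W : ℝ) ≤ N * t / 2 := by
    rw [le_div_iff₀ (by positivity)] at hW1
    linarith
  have hjWN : (4 * j * W : ℝ) ≤ N / 2 := by nlinarith
  have hjN : (j : ℝ) ≤ N / 2 := by
    have : 20 * (r / η) ≤ N / 2 := by
      rw [← mul_div_assoc, div_le_div_iff₀ hη (by norm_num)]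
      have : N * η ^ 3 ≤ N * η := by
        gcongr
        calc η ^ 3 = η * η ^ 2 := by ring
          _ ≤ η * 1 := by gcongr; exact pow_le_one₀ hη.le hη1.le
          _ = η := mul_one _
      nlinarith
    linarith
  have hjWnat : 4 * j * W ≤ N := by
    have : ((4 * j * W : ℕ) : ℝ) ≤ N := by push_cast; linarith
    exact_mod_cast this
  set T : ℝ := μ * N * (1 - t) with hT
  set m : ℝ := μ * (N * t) / 4 with hm
  have hmpos : 0 < m := by positivity
  refine ⟨Finset.Icc ⌈T⌉₊ ⌊T + 258 * m⌋₊, fun x hx => Nat.ceil_le.1 (Finset.mem_Icc.1 hx).1, ?_⟩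
  have hwin : ∀ i ∈ Finset.range W, 1 / 516 ≤ ∑ x ∈ Finset.Icc ⌈T⌉₊ ⌊T + 258 * m⌋₊,
      (geo q).real {x} * ∑ n ∈ Finset.Ico (N - 4 * j * (i + 1)) (N - 4 * j * (i + 1) + 4 * j),
        (M q n).eval (x : ℝ) ^ 2 := by
    intro i hi
    have hi' : i + 1 ≤ W := Finset.mem_range.1 hi
    have hmul : 4 * j * (i + 1) ≤ 4 * j * W := Nat.mul_le_mul_left _ hi'
    have hmulr : (4 * j * (i + 1) : ℝ) ≤ 4 * j * W := by exact_mod_cast hmul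
    have hsub : ((N - 4 * j * (i + 1) : ℕ) : ℝ) = N - 4 * j * (i + 1) := by
      rw [Nat.cast_sub (hmul.trans hjWnat)]; push_cast; ring
    have hstep : 4 * j * (i + 1) = 4 * j * i + 4 * j := by ring
    refine window_mass h0 h1 hjnat ?_ hmpos ?_ ?_ _ fun x => mem_Icc_ceil_floor
    · have : (j : ℝ) ≤ ((N - 4 * j * (i + 1) : ℕ) : ℝ) := by rw [hsub]; linarith
      exact_mod_cast this
    · intro n hn
      rw [Finset.mem_Ico] at hn
      have hn1 : (N : ℝ) - N * t / 2 ≤ n := by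
        have : ((N - 4 * j * (i + 1) : ℕ) : ℝ) ≤ n := by exact_mod_cast hn.1
        rw [hsub] at this
        linarith
      have hn2 : (n : ℝ) ≤ N := by
        have := hmul.trans hjWnat
        exact_mod_cast (by omega : n ≤ N)
      have hs0 := edgeShift_nonneg h0 h1
      have hs1 := edgeShift_le h0 h1
      have k1 := mul_le_mul_of_nonneg_left hn1 hμ.le
      have k2 := mul_le_mul_of_nonneg_left hn2 hμ.le
      have k3 : μ * 1 ≤ μ * (N * t) := mul_le_mul_of_nonneg_left (by linarith) hμ.le
      rw [hm, hT]
      constructor <;> linarith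
    · have hle : N - 4 * j * (i + 1) + 4 * j + 1 ≤ 2 * N := by
        have : 160 ≤ N := by exact_mod_cast hNr
        have := hmul.trans hjWnat
        omega
      refine (mul_le_mul_of_nonneg_left (offCoeff_mono h1 hle) (by norm_num)).trans ?_
      unfold offCoeff
      rw [hsqrt]
      push_cast
      have hg := edge_ge h1
      have hjj : 361 * (r / η) ^ 2 ≤ (j : ℝ) ^ 2 := by
        calc _ = (19 * (r / η)) ^ 2 := by ring
          _ ≤ _ := by gcongr
      calc 45 * (r ^ 3 * (2 * N) / (1 - q)) = 1 / (1 - q) * (N * t) / 4 * (360 * (r / η) ^ 2) := by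
            rw [ht]; field_simp; norm_num
        _ ≤ m * (j : ℝ) ^ 2 := by
            rw [hm]
            have : 360 * (r / η) ^ 2 ≤ (j : ℝ) ^ 2 := by nlinarith [sq_nonneg (r / η)]
            gcongr
  calc N * η ^ 3 / 165120 = (N * η ^ 3 / 320) * (1 / 516) := by ring
    _ ≤ (W : ℝ) * (1 / 516) := by gcongr
    _ = ∑ i ∈ Finset.range W, (1 / 516 : ℝ) := by simp
    _ ≤ _ := Finset.sum_le_sum hwin
    _ = ∑ x ∈ Finset.Icc ⌈T⌉₊ ⌊T + 258 * m⌋₊, (geo q).real {x} *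
          ∑ n ∈ Finset.Ico (N - 4 * j * W) N, (M q n).eval (x : ℝ) ^ 2 := by
        rw [Finset.sum_comm]
        refine Finset.sum_congr rfl fun x _ => ?_
        rw [← Finset.mul_sum, sum_windows _ W hjWnat]
    _ ≤ pointMass q N _ := by
        unfold pointMass
        refine Finset.sum_le_sum fun x _ => mul_le_mul_of_nonneg_left ?_ measureReal_nonneg
        refine Finset.sum_le_sum_of_subset_of_nonneg ?_ fun _ _ _ => sq_nonneg _
        intro n; simp only [Finset.mem_Ico, Finset.mem_range]; omega

/-! ### Growth of the orthonormal polynomials across the edge -/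

/-- A discrete Gronwall estimate for a second order difference equation. -/
theorem growth_bound {u D : ℕ → ℝ} {b v κ : ℝ} {j K : ℕ} (hj : 1 ≤ j) (hb : 0 < b)
    (hκ : 1 ≤ κ) (hvb : v * (j : ℝ) ^ 2 ≤ κ * b)
    (hD : ∀ k < K, |D (k + 1)| ≤ |D k| + v * |u k|)
    (hu : ∀ k < K, |u (k + 1)| ≤ |u k| + |D (k + 1)| / b) :
    ∀ k ≤ K, |u k| + j / b * |D k| ≤ (1 + 2 * κ / j) ^ k * (|u 0| + j / b * |D 0|) := by
  have hjr : (1 : ℝ) ≤ j := by exact_mod_cast hj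
  have hj0 : (0 : ℝ) < j := by linarith
  intro k
  induction k with
  | zero => simp
  | succ k ih =>
    intro hk
    have ih' := ih (by omega)
    have a1 := hD k (by omega)
    have a2 := hu k (by omega)
    have hvb' : v * j / b ≤ κ / j := by
      rw [div_le_div_iff₀ hb hj0]; nlinarith
    -- The weight `j / b` balances value and flux: each then feeds the other with a factor `O(κ /
    -- j)` per step.
    have step : |u (k + 1)| + j / b * |D (k + 1)| ≤
        (1 + 2 * κ / j) * (|u k| + j / b * |D k|) := by
      have c1 : |D (k + 1)| / b ≤ j / b * |D (k + 1)| * (1 / j) := by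
        apply le_of_eq; field_simp
      have c2 : j / b * |D (k + 1)| ≤ j / b * |D k| + κ / j * |u k| := by
        calc j / b * |D (k + 1)| ≤ j / b * (|D k| + v * |u k|) := by gcongr
          _ = j / b * |D k| + v * j / b * |u k| := by ring
          _ ≤ _ := by gcongr
      have c3 : (1 : ℝ) / j ≤ 1 := by rw [div_le_one hj0]; exact hjr
      have c4 : 1 / (j : ℝ) ≤ κ / j := by gcongr
      have d1 : 0 ≤ j / b * |D k| := by positivity
      have d2 : 0 ≤ κ / j * |u k| := by positivity
      have d3 : (1 : ℝ) / j * (j / b * |D (k + 1)|) ≤ 1 / j * (j / b * |D k| + κ / j * |u k|) := by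
        gcongr
      have d4 : 1 / (j : ℝ) * (j / b * |D k|) ≤ κ / j * (j / b * |D k|) := by gcongr
      have d5 : 1 / (j : ℝ) * (κ / j * |u k|) ≤ 1 * (κ / j * |u k|) := by gcongr
      have d6 : 0 ≤ κ / j * (j / b * |D k|) := by positivity
      have e : (1 + 2 * κ / j) * (|u k| + j / b * |D k|) =
          |u k| + j / b * |D k| + 2 * (κ / j * |u k|) + 2 * (κ / j * (j / b * |D k|)) := by ring
      rw [e]
      linarith
    calc _ ≤ _ := step
      _ ≤ (1 + 2 * κ / j) * ((1 + 2 * κ / j) ^ k * (|u 0| + j / b * |D 0|)) := by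
          gcongr
      _ = _ := by ring

/-- Backward control of the increment of a convex increasing sequence. -/
theorem increment_bound {u D β : ℕ → ℝ} {v B : ℝ} {j : ℕ} (hv : 0 ≤ v) (hB : 0 ≤ B)
    (hu0 : 0 ≤ u 0) (hu : ∀ i < j, u i ≤ u (i + 1)) (hβ : ∀ i < j, β i ≤ B)
    (hβD : ∀ i < j, D (i + 1) = β i * (u (i + 1) - u i))
    (hD : ∀ i < j, D (i + 1) ≤ D i + v * u i) :
    j * D j ≤ (B + v * (j : ℝ) ^ 2) * u j := by
  have hmono : ∀ d i, i + d ≤ j → u i ≤ u (i + d) := by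
    intro d i
    induction d with
    | zero => simp
    | succ d ih => exact fun h => (ih (by omega)).trans (hu (i + d) (by omega))
  have hujn : 0 ≤ u j := by
    have := hmono j 0 (by omega)
    rw [zero_add] at this
    exact hu0.trans this
  have hDd : ∀ d i, i + d ≤ j → D (i + d) ≤ D i + d * (v * u j) := by
    intro d i
    induction d with
    | zero => simp
    | succ d ih =>
      intro h
      have a1 := ih (by omega)
      have a2 := hD (i + d) (by omega)
      have a3 := hmono (j - (i + d)) (i + d) (by omega)
      rw [show i + d + (j - (i + d)) = j by omega] at a3
      have a4 := mul_le_mul_of_nonneg_left a3 hv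
      rw [← add_assoc]
      push_cast
      linarith
  -- Each earlier `D (i + 1)` is at least `D j - j v u_j`. Averaging over `j` steps telescopes the
  -- increments of `u`.
  have hsum : ∑ i ∈ Finset.range j, D j ≤
      ∑ i ∈ Finset.range j, (B * (u (i + 1) - u i) + j * (v * u j)) := by
    refine Finset.sum_le_sum fun i hi => ?_
    have hi' := Finset.mem_range.1 hi
    have a1 := hDd (j - (i + 1)) (i + 1) (by omega)
    rw [show i + 1 + (j - (i + 1)) = j by omega, hβD i hi'] at a1
    have a2 := mul_le_mul_of_nonneg_right (hβ i hi') (sub_nonneg.2 (hu i hi'))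
    have a3 : ((j - (i + 1) : ℕ) : ℝ) * (v * u j) ≤ j * (v * u j) := by
      gcongr
      omega
    linarith
  rw [Finset.sum_const, Finset.card_range, nsmul_eq_mul, Finset.sum_add_distrib, ← Finset.mul_sum,
    Finset.sum_range_sub, Finset.sum_const, Finset.card_range, nsmul_eq_mul] at hsum
  have := mul_nonneg hB hu0
  linarith

/-- The discrete flux `b_n (M_n - M_{n-1})`. -/
noncomputable def flux (q x : ℝ) (n : ℕ) : ℝ :=
  offCoeff q n * ((M q n).eval x - (M q (n - 1)).eval x)

/-- The recurrence as a first-order system in value and flux: the flux increases where `x` lies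
above the potential and the value is positive. -/
theorem flux_succ {q : ℝ} (h0 : 0 < q) (h1 : q < 1) (x : ℝ) (n : ℕ) :
    flux q x (n + 1) = flux q x n + (x - (edge q * n + edgeShift q)) * (M q n).eval x := by
  have h := congrArg (Polynomial.eval x) (M_recurrence h0 h1 n)
  simp only [eval_mul, eval_add, eval_X, eval_C] at h
  rw [edge_mul_add_edgeShift h0]
  unfold flux
  simp only [Nat.add_sub_cancel]
  linear_combination -h

theorem edgeShift_lt {q : ℝ} (h0 : 0 < q) (h1 : q < 1) : edgeShift q < edge q := by
  have : 0 < 1 - q := by linarith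
  have hs := Real.sq_sqrt h0.le
  have := Real.sqrt_nonneg q
  unfold edge edgeShift
  gcongr
  nlinarith

/-- Beyond the edge the orthonormal polynomials are positive and increasing in the degree. -/
theorem eval_pos_and_flux_nonneg {q : ℝ} (h0 : 0 < q) (h1 : q < 1) {N : ℕ} {x : ℝ}
    (hx : edge q * N ≤ x) : ∀ n ≤ N, 0 < (M q n).eval x ∧ 0 ≤ flux q x n := by
  intro n
  induction n with
  | zero => intro _; simp [M_zero h0 h1, flux, offCoeff_zero]
  | succ n ih =>
    intro hn
    obtain ⟨a1, a2⟩ := ih (by omega)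
    have hnN : (n : ℝ) + 1 ≤ N := by exact_mod_cast hn
    have hμ := edge_pos h1
    have hV : 0 ≤ x - (edge q * n + edgeShift q) := by
      have := edgeShift_lt h0 h1
      nlinarith
    have a3 : 0 ≤ flux q x (n + 1) := by
      rw [flux_succ h0 h1]
      positivity
    refine ⟨?_, a3⟩
    have hb := offCoeff_pos h0 h1 n
    have : 0 ≤ (M q (n + 1)).eval x - (M q n).eval x := by
      unfold flux at a3
      exact nonneg_of_mul_nonneg_right a3 hb
    linarith

theorem eval_le_succ {q : ℝ} (h0 : 0 < q) (h1 : q < 1) {N : ℕ} {x : ℝ}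
    (hx : edge q * N ≤ x) {n : ℕ} (hn : n < N) : (M q n).eval x ≤ (M q (n + 1)).eval x := by
  have a3 := (eval_pos_and_flux_nonneg h0 h1 hx (n + 1) hn).2
  unfold flux at a3
  exact sub_nonneg.1 (nonneg_of_mul_nonneg_right a3 (offCoeff_pos h0 h1 n))

theorem eval_mono {q : ℝ} (h0 : 0 < q) (h1 : q < 1) {N : ℕ} {x : ℝ}
    (hx : edge q * N ≤ x) {m n : ℕ} (hmn : m ≤ n) (hn : n ≤ N) :
    (M q m).eval x ≤ (M q n).eval x := by
  induction n, hmn using Nat.le_induction with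
  | base => rfl
  | succ n hmn ih => exact (ih (by omega)).trans (eval_le_succ h0 h1 hx hn)

/-- The constant in the comparison of degrees below and above `N`. -/
noncomputable def growthConst : ℝ := Real.exp (220 * 10 ^ 6) * (3 + 10 ^ 6)

/-- On the scale `j³ ≲ √q N` the potential changes the flux too little over `O(j)` degrees for more
than bounded growth. Steps from `N - 2j` to `N - j` bound the initial flux, and Gronwall carries the
bound past `N`, where monotonicity is no longer available. -/
theorem abs_eval_le {q : ℝ} (h0 : 0 < q) (h1 : q < 1) {N j : ℕ} (hj : 1 ≤ j) (hjN : 4 * j ≤ N)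
    (hj3 : (j : ℝ) ^ 3 ≤ 8 * (Real.sqrt q * N)) {x : ℝ} (hx : edge q * N ≤ x)
    (hx' : x ≤ edge q * N + 258 * (52 * edge q * j)) {k : ℕ} (hk : k ≤ 109 * j) :
    |(M q (N - j + k)).eval x| ≤ growthConst * (M q (N - j)).eval x := by
  have hq : 0 < 1 - q := by linarith
  have hs := Real.sqrt_pos.2 h0
  have hs1 : Real.sqrt q ≤ 1 := Real.sqrt_le_one.2 h1.le
  have hμ := edge_pos h1
  have hjr : (1 : ℝ) ≤ j := by exact_mod_cast hj
  have hj0 : (0 : ℝ) < j := by linarith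
  have hNr : (4 * j : ℝ) ≤ N := by exact_mod_cast hjN
  set b : ℝ := offCoeff q N / 2 with hb
  have hbpos : 0 < b := by
    have : 0 < (N : ℝ) := by linarith
    rw [hb]; unfold offCoeff; positivity
  have hbge : ∀ n, N - 2 * j ≤ n → b ≤ offCoeff q n := by
    intro n hn
    have : (N : ℝ) ≤ 2 * n := by exact_mod_cast (by omega : N ≤ 2 * n)
    rw [hb]; unfold offCoeff
    rw [div_div, div_le_div_iff₀ (by positivity) (by positivity)]
    have := mul_le_mul_of_nonneg_left this (mul_pos hs hq).le
    linarith
  -- The window of `x` contributes `258 · 52 = 13416`, and the `2j` degrees below `N` contribute 2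
  -- more.
  set v : ℝ := 13420 * edge q * j with hv
  have hv0 : 0 ≤ v := by positivity
  have hVabs : ∀ n : ℕ, N - 2 * j ≤ n → n ≤ N + 108 * j → |x - (edge q * n + edgeShift q)| ≤ v := by
    intro n hn1 hn2
    have e1 : (N : ℝ) ≤ n + 2 * j := by exact_mod_cast (by omega : N ≤ n + 2 * j)
    have e2 : (n : ℝ) ≤ N + 108 * j := by exact_mod_cast hn2
    have k1 := mul_le_mul_of_nonneg_left e1 hμ.le
    have k2 := mul_le_mul_of_nonneg_left e2 hμ.le
    have k3 := mul_le_mul_of_nonneg_left hjr hμ.le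
    have := edgeShift_le h0 h1
    have := edgeShift_nonneg h0 h1
    rw [abs_le, hv]
    constructor <;> linarith
  have hvb : v * (j : ℝ) ^ 2 ≤ 10 ^ 6 * b := by
    have hle : edge q ≤ 4 / (1 - q) := by
      unfold edge
      gcongr
      nlinarith
    calc v * (j : ℝ) ^ 2 = 13420 * edge q * (j : ℝ) ^ 3 := by rw [hv]; ring
      _ ≤ 13420 * (4 / (1 - q)) * (8 * (Real.sqrt q * N)) := by gcongr
      _ = 858880 * b := by rw [hb]; unfold offCoeff; ring
      _ ≤ _ := by gcongr; norm_num
  have hinc := increment_bound (u := fun i => (M q (N - 2 * j + i)).eval x)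
    (D := fun i => flux q x (N - 2 * j + i)) (β := fun i => offCoeff q (N - 2 * j + i + 1))
    (v := v) (B := 2 * b) (j := j) hv0 (by positivity)
    (eval_pos_and_flux_nonneg h0 h1 hx _ (by omega)).1.le
    (fun i hi => eval_le_succ h0 h1 hx (by omega))
    (fun i hi => by
      rw [hb, mul_div_cancel₀ _ (by norm_num)]
      exact offCoeff_mono h1 (by omega))
    (fun i hi => by rw [← add_assoc]; rfl)
    (fun i hi => by
      rw [← add_assoc, flux_succ h0 h1]
      have a1 := (abs_le.1 (hVabs (N - 2 * j + i) (by omega) (by omega))).2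
      have a2 := (eval_pos_and_flux_nonneg h0 h1 hx (N - 2 * j + i) (by omega)).1.le
      have := mul_le_mul_of_nonneg_right a1 a2
      linarith)
  simp only [show N - 2 * j + j = N - j by omega] at hinc
  have hgr := growth_bound (u := fun i => (M q (N - j + i)).eval x)
    (D := fun i => flux q x (N - j + i)) (b := b) (v := v) (κ := 10 ^ 6) (j := j) (K := 109 * j)
    hj hbpos (by norm_num) hvb
    (fun i hi => by
      rw [← add_assoc, flux_succ h0 h1]
      refine (abs_add_le _ _).trans ?_
      rw [abs_mul]
      have := hVabs (N - j + i) (by omega) (by omega)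
      gcongr)
    (fun i hi => by
      have hbi := hbge (N - j + i + 1) (by omega)
      have e : (M q (N - j + (i + 1))).eval x = (M q (N - j + i)).eval x +
          flux q x (N - j + (i + 1)) / offCoeff q (N - j + i + 1) := by
        unfold flux
        rw [← add_assoc, Nat.add_sub_cancel, mul_div_cancel_left₀ _ (offCoeff_pos h0 h1 _).ne']
        ring
      rw [e]
      refine (abs_add_le _ _).trans ?_
      rw [abs_div, abs_of_pos (offCoeff_pos h0 h1 _)]
      gcongr)
    k hk
  simp only [add_zero] at hgr
  obtain ⟨p1, p2⟩ := eval_pos_and_flux_nonneg h0 h1 hx (N - j) (by omega)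
  rw [abs_of_pos p1, abs_of_nonneg p2] at hgr
  set U := (M q (N - j)).eval x
  have hinit : U + j / b * flux q x (N - j) ≤ (3 + 10 ^ 6) * U := by
    have : j / b * flux q x (N - j) ≤ (2 + 10 ^ 6) * U := by
      rw [div_mul_eq_mul_div, div_le_iff₀ hbpos]
      refine hinc.trans ?_
      have := mul_le_mul_of_nonneg_right hvb p1.le
      linarith
    linarith
  -- The exponent is at most `109 · 2 · 10⁶ = 218 · 10⁶`.
  have hexp : (1 + 2 * 10 ^ 6 / (j : ℝ)) ^ k ≤ Real.exp (220 * 10 ^ 6) := by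
    have h2 : 1 + 2 * 10 ^ 6 / (j : ℝ) ≤ Real.exp (2 * 10 ^ 6 / (j : ℝ)) := by
      rw [add_comm]; exact Real.add_one_le_exp _
    have hkr : (k : ℝ) ≤ 109 * j := by exact_mod_cast hk
    calc _ ≤ Real.exp (2 * 10 ^ 6 / (j : ℝ)) ^ k := by gcongr
      _ = Real.exp (k * (2 * 10 ^ 6 / (j : ℝ))) := (Real.exp_nat_mul _ _).symm
      _ ≤ _ := by
        apply Real.exp_le_exp.2
        rw [← mul_div_assoc, div_le_iff₀ hj0]
        linarith
  have hfl : 0 ≤ j / b * flux q x (N - j) := by positivity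
  calc |(M q (N - j + k)).eval x| ≤ |(M q (N - j + k)).eval x| + j / b * |flux q x (N - j + k)| :=
        le_add_of_nonneg_right (by positivity)
    _ ≤ _ := hgr
    _ ≤ Real.exp (220 * 10 ^ 6) * ((3 + 10 ^ 6) * U) := by gcongr
    _ = growthConst * U := by unfold growthConst; ring

/-! ### A constant expected number of points beyond the edge -/

theorem edge_mass {r : ℝ} (hr0 : 0 < r) (hr : r < 1) {N : ℕ} (hN : 10 ^ 6 ≤ N)
    (hrN : 1 ≤ N * r ^ 3) :
    ∃ S : Finset ℕ, (∀ x ∈ S, edge (r ^ 6) * N ≤ x) ∧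
      1 / (2064 * growthConst ^ 2) ≤ pointMass (r ^ 6) N S := by
  have h0 : 0 < r ^ 6 := by positivity
  have h1 : r ^ 6 < 1 := pow_lt_one₀ hr0.le hr (by norm_num)
  have hsqrt : Real.sqrt (r ^ 6) = r ^ 3 := by
    rw [show r ^ 6 = (r ^ 3) ^ 2 by ring, Real.sqrt_sq (by positivity)]
  set q := r ^ 6 with hq
  have h1q : 0 < 1 - q := by linarith
  have hNr : (10 : ℝ) ^ 6 ≤ N := by exact_mod_cast hN
  have hμ := edge_pos h1
  obtain ⟨ν, hν0, hν⟩ : ∃ ν : ℝ, 0 < ν ∧ ν ^ 3 = N := by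
    refine ⟨(N : ℝ) ^ (1 / 3 : ℝ), Real.rpow_pos_of_pos (by linarith) _, ?_⟩
    rw [← Real.rpow_natCast, ← Real.rpow_mul (by positivity)]
    norm_num
  have hν100 : 100 ≤ ν := by
    refine le_of_pow_le_pow_left₀ (n := 3) (by norm_num) hν0.le ?_
    rw [hν]; linarith
  have hrν : 1 ≤ r * ν := by
    refine le_of_pow_le_pow_left₀ (n := 3) (by norm_num) (by positivity) ?_
    rw [mul_pow, hν]; linarith
  set j : ℕ := ⌈r * ν⌉₊ with hj
  have hj1 : r * ν ≤ j := Nat.le_ceil _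
  have hj2 : (j : ℝ) ≤ 2 * (r * ν) := by
    have := (Nat.ceil_lt_add_one (show 0 ≤ r * ν by positivity)).le
    linarith
  have hjr : (1 : ℝ) ≤ j := by linarith
  have hjnat : 1 ≤ j := by exact_mod_cast hjr
  have hj3 : r ^ 3 * N ≤ (j : ℝ) ^ 3 := by
    rw [← hν, ← mul_pow]; gcongr
  have hj3' : (j : ℝ) ^ 3 ≤ 8 * (r ^ 3 * N) := by
    calc (j : ℝ) ^ 3 ≤ (2 * (r * ν)) ^ 3 := by gcongr
      _ = _ := by rw [← hν]; ring
  have hjN : 4905 * (j : ℝ) ≤ 7 * N := by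
    have : r * ν ≤ 1 * ν := by gcongr
    have : 10000 * ν ≤ ν ^ 3 := by nlinarith [mul_le_mul hν100 hν100 (by norm_num) hν0.le]
    linarith
  have hjNnat : 4905 * j ≤ 7 * N := by exact_mod_cast hjN
  set T : ℝ := edge q * N with hT
  set m : ℝ := 52 * edge q * j with hm
  have hmpos : 0 < m := by positivity
  refine ⟨Finset.Icc ⌈T⌉₊ ⌊T + 258 * m⌋₊, fun x hx => Nat.ceil_le.1 (Finset.mem_Icc.1 hx).1, ?_⟩
  -- The offset `104 j` makes the potential exceed `T` by at least `104 μ j = 2 m`. The bound `4905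
  -- j ≤ 7 N`, with `4905 = 45 · 109`, keeps `45 (N + 108 j + 1) ≤ 52 N`.
  have hwin := window_mass h0 h1 hjnat (a := N + 104 * j) (by omega) (T := T) hmpos
    (by
      intro n hn
      rw [Finset.mem_Ico] at hn
      have e1 : (N : ℝ) + 104 * j ≤ n := by exact_mod_cast hn.1
      have e2 : (n : ℝ) ≤ N + 108 * j := by exact_mod_cast (by omega : n ≤ N + 108 * j)
      have k1 := mul_le_mul_of_nonneg_left e1 hμ.le
      have k2 := mul_le_mul_of_nonneg_left e2 hμ.le
      have k3 := mul_le_mul_of_nonneg_left hjr hμ.le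
      have := edgeShift_le h0 h1
      have := edgeShift_nonneg h0 h1
      rw [hT, hm]
      constructor <;> linarith)
    (by
      unfold offCoeff
      rw [hsqrt]
      have hg := edge_ge h1
      have hN2 : 45 * ((N + 104 * j + 4 * j + 1 : ℕ) : ℝ) ≤ 52 * N := by
        push_cast; linarith
      calc 45 * (r ^ 3 * ((N + 104 * j + 4 * j + 1 : ℕ) : ℝ) / (1 - q)) =
            1 / (1 - q) * r ^ 3 * (45 * ((N + 104 * j + 4 * j + 1 : ℕ) : ℝ)) := by ring
        _ ≤ 1 / (1 - q) * r ^ 3 * (52 * N) := by gcongr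
        _ = 52 * (1 / (1 - q)) * (r ^ 3 * N) := by ring
        _ ≤ 52 * edge q * (j : ℝ) ^ 3 := by gcongr
        _ = _ := by rw [hm]; ring)
    (Finset.Icc ⌈T⌉₊ ⌊T + 258 * m⌋₊) (fun x => mem_Icc_ceil_floor)
  have hG : 0 < growthConst := by unfold growthConst; positivity
  rw [div_le_iff₀ (by positivity)]
  have hcmp : ∑ x ∈ Finset.Icc ⌈T⌉₊ ⌊T + 258 * m⌋₊, (geo q).real {x} *
      ∑ n ∈ Finset.Ico (N + 104 * j) (N + 104 * j + 4 * j), (M q n).eval (x : ℝ) ^ 2 ≤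
      4 * growthConst ^ 2 * pointMass q N (Finset.Icc ⌈T⌉₊ ⌊T + 258 * m⌋₊) := by
    unfold pointMass
    rw [Finset.mul_sum]
    refine Finset.sum_le_sum fun x hx => ?_
    rw [mul_left_comm]
    refine mul_le_mul_of_nonneg_left ?_ measureReal_nonneg
    rw [Finset.mem_Icc] at hx
    have hx1 : T ≤ x := Nat.ceil_le.1 hx.1
    have hx2 : (x : ℝ) ≤ T + 258 * m :=
      (Nat.le_floor_iff (by positivity)).1 hx.2
    have hU := (eval_pos_and_flux_nonneg h0 h1 hx1 (N - j) (by omega)).1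
    set U := (M q (N - j)).eval (x : ℝ)
    -- All `4j` upper values are at most `growthConst * U`, and the `j` values of degrees `N - j` to
    -- `N - 1` are at least `U`; hence the factor `4 * growthConst ^ 2`.
    calc ∑ n ∈ Finset.Ico (N + 104 * j) (N + 104 * j + 4 * j), (M q n).eval (x : ℝ) ^ 2
        ≤ ∑ n ∈ Finset.Ico (N + 104 * j) (N + 104 * j + 4 * j), (growthConst * U) ^ 2 := by
          refine Finset.sum_le_sum fun n hn => ?_
          rw [Finset.mem_Ico] at hn
          have := abs_eval_le h0 h1 hjnat (by omega) (by rw [hsqrt]; exact hj3') hx1 hx2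
            (k := n - (N - j)) (by omega)
          rw [show N - j + (n - (N - j)) = n by omega] at this
          exact sq_le_sq' (by linarith [neg_abs_le ((M q n).eval (x : ℝ))])
            ((le_abs_self _).trans this)
      _ = 4 * growthConst ^ 2 * ∑ n ∈ Finset.Ico (N - j) N, U ^ 2 := by
          rw [Finset.sum_const, Finset.sum_const, Nat.card_Ico, Nat.card_Ico,
            Nat.add_sub_cancel_left, show N - (N - j) = j by omega]
          push_cast [nsmul_eq_mul]
          ring
      _ ≤ 4 * growthConst ^ 2 * ∑ n ∈ Finset.Ico (N - j) N, (M q n).eval (x : ℝ) ^ 2 := by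
          gcongr with n hn
          rw [Finset.mem_Ico] at hn
          exact eval_mono h0 h1 hx1 hn.1 hn.2.le
      _ ≤ _ := by
          refine mul_le_mul_of_nonneg_left ?_ (by positivity)
          refine Finset.sum_le_sum_of_subset_of_nonneg ?_ fun _ _ _ => sq_nonneg _
          intro n; simp only [Finset.mem_Ico, Finset.mem_range]; omega
  linarith

/-! ### Combining the two regimes -/

theorem pointMass_edge_ge {r η : ℝ} (hη : 0 < η) (hηr : η ≤ r) (hr : r < 1) (hη2 : η ^ 2 < 1 / 2)
    {N : ℕ} (hN : 10 ^ 6 ≤ N) (hrN : 1 ≤ N * r ^ 3) :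
    ∃ S : Finset ℕ, (∀ x ∈ S, edge (r ^ 6) * N * (1 - r * η ^ 2) ≤ x) ∧
      1 / (330240 * growthConst ^ 2) * (N * η ^ 3) ≤ pointMass (r ^ 6) N S := by
  have hr0 : 0 < r := hη.trans_le hηr
  have hG : 1 ≤ growthConst := by
    unfold growthConst
    have := Real.one_le_exp (show (0 : ℝ) ≤ 220 * 10 ^ 6 by norm_num)
    nlinarith
  rcases le_or_gt 160 (N * η ^ 3) with h | h
  · obtain ⟨S, hS, hm⟩ := bulk_mass hη hηr hr hη2 h
    refine ⟨S, hS, le_trans ?_ hm⟩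
    rw [div_eq_inv_mul (N * η ^ 3), one_div]
    have hG2 : 1 ≤ growthConst ^ 2 := one_le_pow₀ hG
    refine mul_le_mul_of_nonneg_right (inv_anti₀ (by norm_num) ?_) (by positivity)
    linarith
  · obtain ⟨S, hS, hm⟩ := edge_mass hr0 hr hN hrN
    refine ⟨S, fun x hx => le_trans ?_ (hS x hx), le_trans ?_ hm⟩
    · have hμ := edge_pos (q := r ^ 6) (pow_lt_one₀ hr0.le hr (by norm_num))
      have : 0 ≤ edge (r ^ 6) * N * (r * η ^ 2) := by positivity
      linarith
    · calc 1 / (330240 * growthConst ^ 2) * (N * η ^ 3) ≤ 1 / (330240 * growthConst ^ 2) * 160 := by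
            gcongr
        _ = 1 / (2064 * growthConst ^ 2) := by
            field_simp; norm_num

end Meixner

theorem theoremt :
    ∃ c : ℝ, 0 < c ∧ ∃ N₀ : ℕ, 0 < N₀ ∧
      ∀ N : ℕ, N₀ ≤ N → ∀ ε ∈ Set.Ioo (0 : ℝ) (1 / 2), ∀ q ∈ Set.Ico (ε ^ 3) (1 : ℝ),
        1 / (N : ℝ) ^ 2 ≤ q →
        ∀ P : Measure (Fin N → ℕ), Meixner.IsMeixnerEnsemble q N P →
          c * ε ^ (3 / 2 : ℝ) ≤ (Meixner.meanEmpirical P).real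
            {x : ℕ | Meixner.edge q * N * (1 - q ^ (1 / 6 : ℝ) * ε) ≤ (x : ℝ)} := by
  have hG : 0 < Meixner.growthConst := by unfold Meixner.growthConst; positivity
  refine ⟨1 / (330240 * Meixner.growthConst ^ 2), by positivity, 10 ^ 6, by norm_num, ?_⟩
  rintro N hN ε ⟨hε0, hε1⟩ q ⟨hqε, hq1⟩ hqN P hP
  have hq0 : 0 < q := lt_of_lt_of_le (by positivity) hqε
  have hNpos : 0 < N := by omega
  have hNr : (0 : ℝ) < N := by exact_mod_cast hNpos
  -- These substitutions make all exponents integral: `q ≥ ε³` becomes `η ≤ r`, and `q ≥ N⁻²`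
  -- becomes `N r³ ≥ 1`.
  set r : ℝ := q ^ (1 / 6 : ℝ) with hr
  set η : ℝ := Real.sqrt ε with hη
  have hr0 : 0 < r := Real.rpow_pos_of_pos hq0 _
  have hη0 : 0 < η := Real.sqrt_pos.2 hε0
  have hη2 : η ^ 2 = ε := Real.sq_sqrt hε0.le
  have hr6 : r ^ 6 = q := by
    rw [hr, ← Real.rpow_natCast, ← Real.rpow_mul hq0.le]
    norm_num
  have hη3 : ε ^ (3 / 2 : ℝ) = η ^ 3 := by
    rw [hη, Real.sqrt_eq_rpow, ← Real.rpow_natCast, ← Real.rpow_mul hε0.le]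
    norm_num
  have hηr : η ≤ r := by
    refine le_of_pow_le_pow_left₀ (n := 6) (by norm_num) hr0.le ?_
    rw [hr6, show η ^ 6 = (η ^ 2) ^ 3 by ring, hη2]
    exact hqε
  have hr1 : r < 1 := Real.rpow_lt_one hq0.le hq1 (by norm_num)
  have hrN : 1 ≤ N * r ^ 3 := by
    refine le_of_pow_le_pow_left₀ (n := 2) (by norm_num) (by positivity) ?_
    rw [mul_pow, ← pow_mul, hr6]
    rw [div_le_iff₀ (by positivity)] at hqN
    linarith
  obtain ⟨S, hS, hm⟩ := Meixner.pointMass_edge_ge hη0 hηr hr1 (by rw [hη2]; exact hε1) hN hrN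
  rw [hr6] at hS hm
  rw [hη2] at hS
  refine le_trans ?_ (Meixner.pointMass_div_le hq0 hq1 hNpos hP hS)
  rw [hη3, le_div_iff₀ hNr]
  linarith
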